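/- A $d$-dimensional state is a positive semidefinite $\rho\in\mathbb C^{d\times d}$ with $\operatorname{tr}\rho=1$, and $\|\cdot\|_1$ is the Schatten $1$-norm (sum of the singular values). A tester that uses $t$-copy measurements with private randomness runs in finitely many rounds. In round $i$ it draws a random seed $s_i$, independent of the seeds of the other rounds, performs a POVM that depends only on $i$ and $s_i$ on $t_i$ fresh copies of the unknown state $\rho$, i.e. on $\rho^{\otimes t_i}$, where $1\le t_i\le t$, and records the outcome $x_i$. At the end it answers "equal" or "far" by a (possibly randomized) rule applied to all the pairs $(s_i,x_i)$. It consumes $\sum_i t_i$ copies; this is $nt$ if there are $n$ rounds with $t_i=t$ for all $i$. For $\varepsilon>0$ such a tester *certifies* a given state $\sigma$ if it answers "equal" with probability at least $0.99$ when $\rho=\sigma$, and "far" with probability at least $0.99$ for every state $\rho$ with $\|\rho-\sigma\|_1\ge\varepsilon$. We say that $N$ copies suffice for $(d,t,\varepsilon)$ if for every $d$-dimensional state $\sigma$ there is such a tester (it may depend on $\sigma$) that certifies $\sigma$ and consumes at most $N$ copies. **Theorem.** There are absolute constants $c_0,c>0$ such that the following holds for all integers $d\ge 2$, $t\ge 1$,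 all real $\varepsilon>0$, and all integers $N\ge 0$ such that $N$ copies suffice for $(d,t,\varepsilon)$. 1. If $\varepsilon\le c_0/t$, then $$N\;\ge\; c\,\min\Big\{\frac{d^2}{t\varepsilon^2},\ \frac{1}{t^2\varepsilon^3}\Big\}.$$ 2. If $\varepsilon\le c_0/(d^2t)$, then $$N\;\ge\; c\,\max\Big\{\frac{d^2}{t\varepsilon^2},\ \frac{d}{\varepsilon^2}\Big\}.$$ -/

import Mathlib

open MeasureTheory ProbabilityTheory
open scoped ComplexOrder

universe u

/-- A quantum state (density matrix): positive semidefinite with unit trace. -/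
structure IsState {ι : Type*} [Fintype ι] (ρ : Matrix ι ι ℂ) : Prop where
  posSemidef : ρ.PosSemidef
  trace_eq_one : ρ.trace = 1

/-- The Schatten 1-norm: the sum of the singular values of `A`, which are the square roots of
the eigenvalues of `Aᴴ * A`. -/
noncomputable def traceNorm {ι : Type*} [Fintype ι] [DecidableEq ι] (A : Matrix ι ι ℂ) : ℝ :=
  ∑ i, √((Matrix.isHermitian_conjTranspose_mul_self A).eigenvalues i)

/-- The tensor power `ρ^{⊗ k}`, in the product basis of `(ℂ^d)^{⊗ k}`. -/
def tensorPower {d : ℕ} (k : ℕ) (ρ : Matrix (Fin d) (Fin d) ℂ) :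
    Matrix (Fin k → Fin d) (Fin k → Fin d) ℂ :=
  Matrix.of fun a b => ∏ j, ρ (a j) (b j)

/-- `{M x}` is a POVM with outcomes `x` in `X`: every `M x` is positive semidefinite and
`∫ M x ∂ν = 1`. If `X` is countable and `ν` is the counting measure, this is a family of positive
semidefinite matrices with `∑ x, M x = 1`. The reference measure `ν` admits continuous
POVMs too (an arbitrary POVM in finite dimension has a density with respect to its trace). -/
structure IsPOVM {ι : Type*} [DecidableEq ι] {X : Type*} [MeasurableSpace X]
    (ν : Measure X) (M : X → Matrix ι ι ℂ) : Prop where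
  posSemidef : ∀ x, (M x).PosSemidef
  integrable : ∀ a b, Integrable (fun x => M x a b) ν
  integral_eq_one : ∀ a b, ∫ x, M x a b ∂ν = (1 : Matrix ι ι ℂ) a b

/-- A POVM that is drawn at random: a random seed `s` is sampled from the probability law
`seedLaw`, and the POVM `{op s x}` is then performed. Everything is jointly measurable. -/
structure RandomPOVM (ι : Type*) [DecidableEq ι] where
  Seed : Type u
  Outcome : Type u
  [measurableSeed : MeasurableSpace Seed]
  [measurableOutcome : MeasurableSpace Outcome]
  seedLaw : Measure Seed
  [isProbabilityMeasure_seedLaw : IsProbabilityMeasure seedLaw]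
  ref : Kernel Seed Outcome
  [isSFiniteKernel_ref : IsSFiniteKernel ref]
  op : Seed → Outcome → Matrix ι ι ℂ
  measurable_op : ∀ a b, Measurable fun y : Seed × Outcome => op y.1 y.2 a b
  isPOVM : ∀ s, IsPOVM (ref s) (op s)

attribute [instance] RandomPOVM.measurableSeed RandomPOVM.measurableOutcome
  RandomPOVM.isProbabilityMeasure_seedLaw RandomPOVM.isSFiniteKernel_ref

/-- The joint law of the seed `s` and the outcome `x` when the state `τ` is measured: `s` has law
`seedLaw`, and given `s` the outcome has density `tr (op s x * τ)` (Born's rule). -/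
noncomputable def RandomPOVM.law {ι : Type*} [Fintype ι] [DecidableEq ι]
    (M : RandomPOVM.{u} ι) (τ : Matrix ι ι ℂ) : Measure (M.Seed × M.Outcome) :=
  (M.seedLaw ⊗ₘ M.ref).withDensity fun y => ENNReal.ofReal (M.op y.1 y.2 * τ).trace.re

/-- A tester that uses `t`-copy measurements drawn with private randomness. In round `i` a random
POVM is drawn with a seed of its own and performed on `size i ≤ t` fresh copies of the unknown
state. After the last round the tester sees all seeds and all outcomes, and answers `equal` with
probability `accept` and `far` otherwise. -/
structure PrivateTester (d t : ℕ) where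
  rounds : ℕ
  size : Fin rounds → ℕ
  one_le_size : ∀ i, 1 ≤ size i
  size_le : ∀ i, size i ≤ t
  meas : ∀ i, RandomPOVM.{u} (Fin (size i) → Fin d)
  accept : (∀ i, (meas i).Seed × (meas i).Outcome) → ℝ
  measurable_accept : Measurable accept
  accept_nonneg : ∀ y, 0 ≤ accept y
  accept_le_one : ∀ y, accept y ≤ 1

namespace PrivateTester

variable {d t : ℕ}

/-- The total number of copies of the unknown state that are consumed. -/
def copies (T : PrivateTester.{u} d t) : ℕ := ∑ i, T.size i

/-- The probability of the answer `equal` when the unknown state is `ρ`. The seeds and outcomes of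
different rounds are independent. -/
noncomputable def acceptProb (T : PrivateTester.{u} d t) (ρ : Matrix (Fin d) (Fin d) ℂ) : ℝ :=
  ∫ y, T.accept y ∂(Measure.pi fun i => (T.meas i).law (tensorPower (T.size i) ρ))

/-- `T` performs `ε`-trace norm certification of `σ`: it tells `ρ = σ` from `‖ρ - σ‖₁ ≥ ε` with
probability at least `0.99`. -/
def Certifies (T : PrivateTester.{u} d t) (ε : ℝ) (σ : Matrix (Fin d) (Fin d) ℂ) : Prop :=
  99 / 100 ≤ T.acceptProb σ ∧
    ∀ ρ, IsState ρ → ε ≤ traceNorm (ρ - σ) → 99 / 100 ≤ 1 - T.acceptProb ρ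

end PrivateTester

/-- `N` copies suffice for `ε`-trace norm certification of `d`-dimensional states with `t`-copy
measurements drawn with private randomness. The tester may depend on the hypothesis state. -/
def CopiesSuffice (d t : ℕ) (ε : ℝ) (N : ℕ) : Prop :=
  ∀ σ : Matrix (Fin d) (Fin d) ℂ, IsState σ →
    ∃ T : PrivateTester.{u} d t, T.copies ≤ N ∧ T.Certifies ε σ

/-!
The theorem is a second-moment (`χ²`) argument against a prior that depends on the tester. Since
the seeds are private, a tester is a fixed product of POVMs, the seed of a round being part of its
outcome. Take for `σ` the maximally mixed state of an `n`-dimensional coordinate subspace and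
perturb it to `(1 + E) / n` on that subspace, with `E` real, symmetric and traceless. The real
parts of the POVM matrices are then all that matters. With `k` copies in a round, the likelihood
ratio to `σ` is the statistic `response` of `(1 + E)^{⊗ k}`.

* Inside `(1 + E)^{⊗ k}` the parts of order `0`, of order `1` and of higher order are orthogonal
  (`trace_higherOrder_sq`), and a second moment of a statistic is at most the normalized squared
  Frobenius norm of its matrix (`IsRealPOVM.pairing_self_le`). So for `ε` small against `1 / (n² t)` only
  the first-order part counts, and the overlap of the likelihood ratios of `E` and `F` is
  controlled by a positive semidefinite form `PrivateTester.infoForm` in `E` and `F`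
  (`PrivateTester.prod_overlap_le`).
* For a total of `N` copies this form is at most `N / n` times the squared Frobenius norm
  (`PrivateTester.infoForm_self_le`), and its trace over the off-diagonal symmetric matrices is at
  most `t N` by Bessel's inequality for the sum of the one-copy marginals
  (`sum_trace_mul_firstOrder_offDiag_sq_le`). Of order `n²` eigendirections `V a` of the form thus
  have eigenvalues of order at most `min (N / n) (t N / n²)` (`exists_insensitive_family`).
* The prior takes `E` proportional to `∑ a, z a • V a` with random signs `z`. In an eigenbasis the
  second moment of the mixture factorizes into hyperbolic cosines (`sum_exp_signs_le`), so it
  stays close to `1` unless `N` is of order `n² / (t ε²)` or of order `n / ε²`, whichever is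
  larger (`not_certifies_of_copies_le`).
* Most of the perturbations are far from `σ`: the fourth moment of a random signed sum is bounded
  (`sum_trace_signSum_pow_four_le`), and a matrix with a given Frobenius norm and a small fourth
  moment has a large trace norm (`le_traceNorm`).

The second part of the theorem is the case `n = d`. For the first part, `n` is `d` if `ε` is small
enough for that, and otherwise of order `(t ε)^(-1/2)`, in which case `n² / (t ε²)` is of order
`1 / (t² ε³)`.
-/

/-! ### Positive semidefinite matrices -/

section PosSemidef

variable {ι : Type*}

namespace Matrix.PosSemidef

theorem sq_apply_le {A : Matrix ι ι ℝ} (hA : A.PosSemidef) (p q : ι) :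
    A p q ^ 2 ≤ A p p * A q q := by
  have h := (hA.submatrix ![p, q]).det_nonneg
  have hs : A q p = A p q := by simpa using hA.1.apply p q
  rw [Matrix.det_fin_two] at h
  simp [hs] at h
  nlinarith

variable [Fintype ι]

theorem sum_sq_le_trace_sq {A : Matrix ι ι ℝ} (hA : A.PosSemidef) :
    ∑ p, ∑ q, A p q ^ 2 ≤ A.trace ^ 2 := by
  calc ∑ p, ∑ q, A p q ^ 2 ≤ ∑ p, ∑ q, A p p * A q q :=
        Finset.sum_le_sum fun p _ => Finset.sum_le_sum fun q _ => hA.sq_apply_le p q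
    _ = A.trace ^ 2 := by
        rw [sq, Matrix.trace, Finset.sum_mul_sum]; rfl

theorem abs_apply_le_trace {A : Matrix ι ι ℝ} (hA : A.PosSemidef) (p q : ι) :
    |A p q| ≤ A.trace := by
  refine abs_le_of_sq_le_sq ?_ hA.trace_nonneg
  calc A p q ^ 2 ≤ ∑ q, A p q ^ 2 :=
        Finset.single_le_sum (f := fun q => A p q ^ 2) (fun _ _ => sq_nonneg _) (Finset.mem_univ q)
    _ ≤ ∑ p, ∑ q, A p q ^ 2 :=
        Finset.single_le_sum (f := fun p => ∑ q, A p q ^ 2)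
          (fun _ _ => Finset.sum_nonneg fun _ _ => sq_nonneg _) (Finset.mem_univ p)
    _ ≤ _ := hA.sum_sq_le_trace_sq

theorem abs_trace_mul_le {A : Matrix ι ι ℝ} (hA : A.PosSemidef) (X : Matrix ι ι ℝ) :
    |(A * X).trace| ≤ A.trace * ∑ a, ∑ b, |X b a| := by
  simp only [Matrix.trace, Matrix.diag, Matrix.mul_apply, Finset.mul_sum]
  refine (Finset.abs_sum_le_sum_abs _ _).trans (Finset.sum_le_sum fun a _ => ?_)
  refine (Finset.abs_sum_le_sum_abs _ _).trans (Finset.sum_le_sum fun b _ => ?_)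
  rw [abs_mul]
  exact mul_le_mul_of_nonneg_right (hA.abs_apply_le_trace a b) (abs_nonneg _)

/-- The entrywise real part of a positive semidefinite matrix is positive semidefinite. -/
theorem map_re {A : Matrix ι ι ℂ} (hA : A.PosSemidef) :
    (A.map Complex.re).PosSemidef := by
  refine Matrix.PosSemidef.of_dotProduct_mulVec_nonneg ?_ fun x => ?_
  · ext a b
    have := congrArg Complex.re (hA.1.apply a b)
    simpa using this
  · have h := hA.dotProduct_mulVec_nonneg (fun i => (x i : ℂ))
    have h' := (Complex.le_def.1 h).1
    simpa [dotProduct, Matrix.mulVec, Complex.re_sum, Finset.mul_sum] using h'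

variable [DecidableEq ι]

/-- The Cauchy–Schwarz inequality for the form `(X, Y) ↦ tr (A X Y)`, with `Y = 1`. -/
theorem trace_mul_sq_le {A X : Matrix ι ι ℝ} (hA : A.PosSemidef) (hX : X.IsSymm) :
    (A * X).trace ^ 2 ≤ A.trace * (A * (X * X)).trace := by
  have key : ∀ s : ℝ, 0 ≤ A.trace * (s * s) + (-2 * (A * X).trace) * s
      + (A * (X * X)).trace := by
    intro s
    have h := (hA.mul_mul_conjTranspose_same (X - s • (1 : Matrix ι ι ℝ))).trace_nonneg
    have e : ((X - s • (1 : Matrix ι ι ℝ)) * A * (X - s • (1 : Matrix ι ι ℝ)).conjTranspose).trace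
        = A.trace * (s * s) + (-2 * (A * X).trace) * s + (A * (X * X)).trace := by
      have h1 : (X - s • (1 : Matrix ι ι ℝ)).conjTranspose = X - s • (1 : Matrix ι ι ℝ) := by
        simp [Matrix.conjTranspose_eq_transpose_of_trivial, hX.eq]
      rw [h1, Matrix.mul_assoc, Matrix.trace_mul_comm]
      simp only [Matrix.mul_sub, Matrix.sub_mul, Matrix.trace_sub, Matrix.mul_smul,
        Matrix.smul_mul, Matrix.trace_smul, Matrix.mul_one, smul_eq_mul,
        Matrix.mul_assoc]
      ring
    linarith
  have := discrim_le_zero key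
  unfold discrim at this
  nlinarith

end Matrix.PosSemidef

variable [Fintype ι] [DecidableEq ι]

/-- A symmetric perturbation of the identity of Frobenius norm at most one is positive
semidefinite. -/
theorem posSemidef_one_add {E : Matrix ι ι ℝ} (hE : E.IsSymm) (h : (E * E).trace ≤ 1) :
    (1 + E).PosSemidef := by
  refine Matrix.PosSemidef.of_dotProduct_mulVec_nonneg ?_ fun x => ?_
  · simp [Matrix.IsHermitian, Matrix.conjTranspose_eq_transpose_of_trivial, hE.eq]
  · have hF : ∑ i, ∑ j, E i j ^ 2 ≤ 1 := by
      refine le_trans (le_of_eq ?_) h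
      simp only [Matrix.trace, Matrix.diag, Matrix.mul_apply]
      refine Finset.sum_congr rfl fun i _ => Finset.sum_congr rfl fun j _ => ?_
      rw [hE.apply j i, sq]
    have hx : 0 ≤ ∑ i, x i ^ 2 := Finset.sum_nonneg fun _ _ => sq_nonneg _
    have hbil : (∑ i, ∑ j, E i j * (x i * x j)) ^ 2 ≤ (∑ i, x i ^ 2) ^ 2 := by
      have h1 := Finset.sum_mul_sq_le_sq_mul_sq (Finset.univ : Finset (ι × ι))
        (fun p => E p.1 p.2) (fun p => x p.1 * x p.2)
      rw [Fintype.sum_prod_type, Fintype.sum_prod_type, Fintype.sum_prod_type] at h1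
      have h2 : ∑ i, ∑ j, (x i * x j) ^ 2 = (∑ i, x i ^ 2) ^ 2 := by
        rw [sq (∑ i, x i ^ 2), Finset.sum_mul_sum]
        simp only [mul_pow]
      simp only at h1
      rw [h2] at h1
      nlinarith [sq_nonneg (∑ i, x i ^ 2)]
    have := abs_le_of_sq_le_sq hbil hx
    have e : star x ⬝ᵥ ((1 + E).mulVec x) = ∑ i, x i ^ 2 + ∑ i, ∑ j, E i j * (x i * x j) := by
      rw [Matrix.add_mulVec, Matrix.one_mulVec, dotProduct_add]
      simp only [dotProduct, star_trivial, Matrix.mulVec, Finset.mul_sum]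
      congr 1
      · exact Finset.sum_congr rfl fun i _ => (sq (x i)).symm
      · exact Finset.sum_congr rfl fun i _ => Finset.sum_congr rfl fun j _ => by ring
    rw [e]
    linarith [(abs_le.1 this).1]

/-- A lower bound on the Schatten 1-norm by the second and fourth moments of the singular values.
It is `u ≥ (3 u² - u⁴) / 2`, applied to `u = s / τ` for every singular value `s`. -/
theorem le_traceNorm (D : Matrix ι ι ℂ) {τ : ℝ} (hτ : 0 < τ) :
    (3 * (D.conjTranspose * D).trace.re / τ
      - ((D.conjTranspose * D) * (D.conjTranspose * D)).trace.re / τ ^ 3) / 2 ≤ traceNorm D := by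
  have hH := Matrix.isHermitian_conjTranspose_mul_self D
  have hpos : ∀ i, 0 ≤ hH.eigenvalues i :=
    (Matrix.posSemidef_conjTranspose_mul_self D).eigenvalues_nonneg
  have h1 : (D.conjTranspose * D).trace.re = ∑ i, hH.eigenvalues i := by
    rw [hH.trace_eq_sum_eigenvalues]; simp
  have h2 : ((D.conjTranspose * D) * (D.conjTranspose * D)).trace.re
      = ∑ i, hH.eigenvalues i ^ 2 := by
    have hs := hH.spectral_theorem
    have : (D.conjTranspose * D) * (D.conjTranspose * D) =
        Unitary.conjStarAlgAut ℂ _ hH.eigenvectorUnitary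
          (Matrix.diagonal fun i => ((hH.eigenvalues i : ℂ) * (hH.eigenvalues i : ℂ))) := by
      conv_lhs => rw [hs, ← map_mul, Matrix.diagonal_mul_diagonal]
      rfl
    rw [this, Unitary.conjStarAlgAut_apply, Matrix.trace_mul_comm, ← Matrix.mul_assoc]
    simp [Matrix.trace, Complex.re_sum, sq]
  rw [h1, h2, traceNorm, Finset.mul_sum, Finset.sum_div, Finset.sum_div, ← Finset.sum_sub_distrib,
    Finset.sum_div]
  refine Finset.sum_le_sum fun i _ => ?_
  obtain ⟨s, hs⟩ : ∃ s, s = √(hH.eigenvalues i) := ⟨_, rfl⟩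
  have hs0 : 0 ≤ s := hs ▸ Real.sqrt_nonneg _
  have hsq : hH.eigenvalues i = s ^ 2 := by rw [hs, Real.sq_sqrt (hpos i)]
  have : √(hH.eigenvalues i) = s := hs.symm
  rw [this, hsq]
  have hu : 0 ≤ s / τ := by positivity
  have e : s - (3 * s ^ 2 / τ - (s ^ 2) ^ 2 / τ ^ 3) / 2
      = τ / 2 * (s / τ) * ((s / τ - 1) ^ 2 * (s / τ + 2)) := by
    field_simp; ring
  have : 0 ≤ τ / 2 * (s / τ) * ((s / τ - 1) ^ 2 * (s / τ + 2)) := by positivity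
  linarith

end PosSemidef

/-! ### Tensor products of matrices -/

section Tensor

variable {k n : ℕ}

/-- The tensor product `A 0 ⊗ ⋯ ⊗ A (k - 1)`, in the product basis. -/
def tensorProd (A : Fin k → Matrix (Fin n) (Fin n) ℝ) :
    Matrix (Fin k → Fin n) (Fin k → Fin n) ℝ :=
  Matrix.of fun a b => ∏ j, A j (a j) (b j)

theorem trace_tensorProd (A : Fin k → Matrix (Fin n) (Fin n) ℝ) :
    (tensorProd A).trace = ∏ j, (A j).trace := by
  simp only [Matrix.trace, Matrix.diag, tensorProd, Matrix.of_apply]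
  rw [Finset.prod_univ_sum, Fintype.piFinset_univ]

theorem tensorProd_mul (A B : Fin k → Matrix (Fin n) (Fin n) ℝ) :
    tensorProd A * tensorProd B = tensorProd fun j => A j * B j := by
  ext a b
  simp only [Matrix.mul_apply, tensorProd, Matrix.of_apply, ← Finset.prod_mul_distrib]
  rw [Finset.prod_univ_sum, Fintype.piFinset_univ]

theorem tensorProd_one : tensorProd (fun _ : Fin k => (1 : Matrix (Fin n) (Fin n) ℝ)) = 1 := by
  ext a b
  simp only [tensorProd, Matrix.of_apply, Matrix.one_apply, funext_iff]
  rw [Fintype.prod_ite_zero]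
  simp

theorem tensorProd_isSymm {A : Fin k → Matrix (Fin n) (Fin n) ℝ} (hA : ∀ j, (A j).IsSymm) :
    (tensorProd A).IsSymm := by
  ext a b
  simp only [Matrix.transpose_apply, tensorProd, Matrix.of_apply]
  exact Finset.prod_congr rfl fun j _ => (hA j).apply _ _

/-- The operator `1 ⊗ ⋯ ⊗ E ⊗ ⋯ ⊗ 1` with `E` in position `j`. -/
def siteOp (k : ℕ) (j : Fin k) (E : Matrix (Fin n) (Fin n) ℝ) :
    Matrix (Fin k → Fin n) (Fin k → Fin n) ℝ :=
  tensorProd (Function.update (fun _ => 1) j E)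

/-- The first-order part `∑ j, 1 ⊗ ⋯ ⊗ E ⊗ ⋯ ⊗ 1` of `(1 + E)^{⊗ k}`. -/
def firstOrder (k : ℕ) (E : Matrix (Fin n) (Fin n) ℝ) :
    Matrix (Fin k → Fin n) (Fin k → Fin n) ℝ :=
  ∑ j, siteOp k j E

/-- What is left of `(1 + E)^{⊗ k}` after the terms of order zero and one. -/
def higherOrder (k : ℕ) (E : Matrix (Fin n) (Fin n) ℝ) :
    Matrix (Fin k → Fin n) (Fin k → Fin n) ℝ :=
  tensorProd (fun _ => 1 + E) - 1 - firstOrder k E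

theorem siteOp_apply (j : Fin k) (E : Matrix (Fin n) (Fin n) ℝ) (a b : Fin k → Fin n) :
    siteOp k j E a b = E (a j) (b j) * ∏ i ∈ Finset.univ.erase j, (1 : Matrix _ _ ℝ) (a i) (b i) := by
  simp only [siteOp, tensorProd, Matrix.of_apply]
  rw [← Finset.mul_prod_erase _ _ (Finset.mem_univ j)]
  congr 1
  · simp
  · refine Finset.prod_congr rfl fun i hi => ?_
    rw [Function.update_of_ne (Finset.ne_of_mem_erase hi)]

theorem siteOp_add (j : Fin k) (E F : Matrix (Fin n) (Fin n) ℝ) :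
    siteOp k j (E + F) = siteOp k j E + siteOp k j F := by
  ext a b; simp [siteOp_apply, add_mul]

theorem siteOp_smul (j : Fin k) (c : ℝ) (E : Matrix (Fin n) (Fin n) ℝ) :
    siteOp k j (c • E) = c • siteOp k j E := by
  ext a b; simp [siteOp_apply, mul_assoc]

theorem siteOp_isSymm (j : Fin k) {E : Matrix (Fin n) (Fin n) ℝ} (hE : E.IsSymm) :
    (siteOp k j E).IsSymm := by
  refine tensorProd_isSymm fun i => ?_
  by_cases h : i = j
  · subst h; simpa using hE
  · simp [h]

theorem firstOrder_add (E F : Matrix (Fin n) (Fin n) ℝ) :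
    firstOrder k (E + F) = firstOrder k E + firstOrder k F := by
  simp [firstOrder, siteOp_add, Finset.sum_add_distrib]

theorem firstOrder_smul (c : ℝ) (E : Matrix (Fin n) (Fin n) ℝ) :
    firstOrder k (c • E) = c • firstOrder k E := by
  simp [firstOrder, siteOp_smul, Finset.smul_sum]

theorem isSymm_sum {ι κ : Type*} (s : Finset κ) {A : κ → Matrix ι ι ℝ}
    (hA : ∀ j ∈ s, (A j).IsSymm) : (∑ j ∈ s, A j).IsSymm := by
  rw [Matrix.IsSymm, Matrix.transpose_sum]
  exact Finset.sum_congr rfl hA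

theorem firstOrder_isSymm {E : Matrix (Fin n) (Fin n) ℝ} (hE : E.IsSymm) :
    (firstOrder k E).IsSymm :=
  isSymm_sum _ fun j _ => siteOp_isSymm j hE

theorem higherOrder_isSymm {E : Matrix (Fin n) (Fin n) ℝ} (hE : E.IsSymm) :
    (higherOrder k E).IsSymm :=
  ((tensorProd_isSymm fun _ => Matrix.isSymm_one.add hE).sub Matrix.isSymm_one).sub
    (firstOrder_isSymm hE)

theorem trace_siteOp (j : Fin k) {E : Matrix (Fin n) (Fin n) ℝ} (hE : E.trace = 0) :
    (siteOp k j E).trace = 0 := by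
  rw [siteOp, trace_tensorProd]
  exact Finset.prod_eq_zero (Finset.mem_univ j) (by simpa using hE)

theorem trace_firstOrder {E : Matrix (Fin n) (Fin n) ℝ} (hE : E.trace = 0) :
    (firstOrder k E).trace = 0 := by
  simp [firstOrder, Matrix.trace_sum, trace_siteOp _ hE]

/-- `tr ((1 + E)^{⊗ k} · E^{(j)}) = tr (E²) n ^ (k - 1)`. -/
theorem trace_tensorProd_mul_siteOp (j : Fin k) {E : Matrix (Fin n) (Fin n) ℝ}
    (hE : E.trace = 0) :
    (tensorProd (fun _ => 1 + E) * siteOp k j E).trace = (E * E).trace * (n : ℝ) ^ (k - 1) := by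
  rw [siteOp, tensorProd_mul, trace_tensorProd, ← Finset.mul_prod_erase _ _ (Finset.mem_univ j)]
  congr 1
  · simp [add_mul, Matrix.trace_add, hE]
  · rw [Finset.prod_congr rfl (g := fun _ => (n : ℝ))]
    · simp [Finset.prod_const, Finset.card_erase_of_mem]
    · intro i hi
      rw [Function.update_of_ne (Finset.ne_of_mem_erase hi)]
      simp [Matrix.trace_add, hE]

theorem trace_siteOp_mul_siteOp (i j : Fin k) {E : Matrix (Fin n) (Fin n) ℝ}
    (hE : E.trace = 0) :
    (siteOp k i E * siteOp k j E).trace =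
      if i = j then (E * E).trace * (n : ℝ) ^ (k - 1) else 0 := by
  rw [siteOp, siteOp, tensorProd_mul, trace_tensorProd,
    ← Finset.mul_prod_erase _ _ (Finset.mem_univ j)]
  split_ifs with h
  · subst h
    congr 1
    · simp
    · rw [Finset.prod_congr rfl (g := fun _ => (n : ℝ))]
      · simp [Finset.prod_const, Finset.card_erase_of_mem]
      · intro l hl
        rw [Function.update_of_ne (Finset.ne_of_mem_erase hl)]
        simp
  · have : j ≠ i := fun h' => h h'.symm
    simp [Function.update_of_ne this, hE]

theorem trace_firstOrder_sq {E : Matrix (Fin n) (Fin n) ℝ} (hE : E.trace = 0) :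
    (firstOrder k E * firstOrder k E).trace = k * ((E * E).trace * (n : ℝ) ^ (k - 1)) := by
  simp [firstOrder, Finset.sum_mul_sum, Matrix.trace_sum, trace_siteOp_mul_siteOp _ _ hE]

theorem trace_higherOrder {E : Matrix (Fin n) (Fin n) ℝ} (hE : E.trace = 0) :
    (higherOrder k E).trace = 0 := by
  simp [higherOrder, Matrix.trace_sub, trace_tensorProd, trace_firstOrder hE, Matrix.trace_add, hE]

/-- The terms of different order in `(1 + E)^{⊗ k}` are orthogonal when `E` is traceless, so the
square of the higher-order part is what is left of `tr ((1 + E)²) ^ k`. -/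
theorem trace_higherOrder_sq {E : Matrix (Fin n) (Fin n) ℝ} (hE : E.trace = 0) :
    (higherOrder k E * higherOrder k E).trace =
      (n + (E * E).trace) ^ k - (n : ℝ) ^ k - k * ((E * E).trace * (n : ℝ) ^ (k - 1)) := by
  have hX2 : (tensorProd (fun _ : Fin k => 1 + E) * tensorProd (fun _ => 1 + E)).trace
      = (n + (E * E).trace) ^ k := by
    rw [tensorProd_mul, trace_tensorProd]
    simp [add_mul, mul_add, Matrix.trace_add, hE]
  have hX : (tensorProd (fun _ : Fin k => 1 + E)).trace = (n : ℝ) ^ k := by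
    rw [trace_tensorProd]; simp [Matrix.trace_add, hE]
  have hXY : (tensorProd (fun _ : Fin k => 1 + E) * firstOrder k E).trace
      = k * ((E * E).trace * (n : ℝ) ^ (k - 1)) := by
    simp [firstOrder, Finset.mul_sum, Matrix.trace_sum, trace_tensorProd_mul_siteOp _ hE]
  have hYX : (firstOrder k E * tensorProd (fun _ : Fin k => 1 + E)).trace
      = k * ((E * E).trace * (n : ℝ) ^ (k - 1)) := by
    rw [Matrix.trace_mul_comm, hXY]
  have h1 : (1 : Matrix (Fin k → Fin n) (Fin k → Fin n) ℝ).trace = (n : ℝ) ^ k := by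
    simp [Matrix.trace_one]
  simp only [higherOrder, Matrix.sub_mul, Matrix.mul_sub, Matrix.trace_sub, hX2, hXY, hYX, hX,
    trace_firstOrder_sq hE, Matrix.one_mul, Matrix.mul_one, h1, trace_firstOrder hE]
  ring

theorem trace_firstOrder_sq_div [NeZero n] {E : Matrix (Fin n) (Fin n) ℝ} (hE : E.trace = 0) :
    (firstOrder k E * firstOrder k E).trace / (n : ℝ) ^ k = k * ((E * E).trace / n) := by
  have hn : (n : ℝ) ≠ 0 := Nat.cast_ne_zero.2 (NeZero.ne n)
  rw [trace_firstOrder_sq hE]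
  rcases k with _ | k
  · simp
  · field_simp; simp [pow_succ]; ring

theorem trace_sq_nonneg {ι : Type*} [Fintype ι] {E : Matrix ι ι ℝ} (hE : E.IsSymm) :
    0 ≤ (E * E).trace := by
  simp only [Matrix.trace, Matrix.diag, Matrix.mul_apply]
  refine Finset.sum_nonneg fun i _ => Finset.sum_nonneg fun j _ => ?_
  rw [hE.apply i j]; exact mul_self_nonneg _

theorem trace_higherOrder_sq_div_le [NeZero n] {E : Matrix (Fin n) (Fin n) ℝ} (hS : E.IsSymm)
    (hE : E.trace = 0) (h : k * ((E * E).trace / n) ≤ 1) :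
    (higherOrder k E * higherOrder k E).trace / (n : ℝ) ^ k ≤ (k * ((E * E).trace / n)) ^ 2 := by
  have hn : (n : ℝ) ≠ 0 := Nat.cast_ne_zero.2 (NeZero.ne n)
  obtain ⟨e, he⟩ : ∃ e, e = (E * E).trace / n := ⟨_, rfl⟩
  have he0 : 0 ≤ e := he ▸ div_nonneg (trace_sq_nonneg hS) (Nat.cast_nonneg n)
  have hT : (E * E).trace = n * e := by rw [he]; field_simp
  rw [← he] at h ⊢
  have hid : (higherOrder k E * higherOrder k E).trace / (n : ℝ) ^ k = (1 + e) ^ k - 1 - k * e := by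
    rw [trace_higherOrder_sq hE, hT]
    have : (n + n * e) ^ k = (n : ℝ) ^ k * (1 + e) ^ k := by rw [← mul_pow]; ring
    rw [this]
    rcases k with _ | k
    · simp
    · field_simp
      simp [pow_succ]
      ring
  have h1 : (1 + e) ^ k ≤ Real.exp (k * e) := by
    rw [Real.exp_nat_mul]
    exact pow_le_pow_left₀ (by linarith) (by linarith [Real.add_one_le_exp e]) k
  have h2 := Real.abs_exp_sub_one_sub_id_le (x := k * e) (by rw [abs_of_nonneg (by positivity)]; exact h)
  rw [hid]
  linarith [(abs_le.1 h2).2]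

end Tensor

/-! ### Random signs -/

section RandomSigns

variable {κ ι : Type*} [Fintype κ] [DecidableEq κ] [Fintype ι]

/-- The matrix `∑ a ∈ S, z a • V a`, for a family of signs `z`. -/
def signSum (V : κ → Matrix ι ι ℝ) (S : Finset κ) (z : κ → ℤˣ) : Matrix ι ι ℝ :=
  ∑ a ∈ S, ((z a : ℤ) : ℝ) • V a

/-- Averaging over all signs is not changed by flipping the sign at `a` first. -/
theorem sum_signs_eq_half (a : κ) (f : (κ → ℤˣ) → ℝ) :
    ∑ z, f z = (∑ z, (f z + f (z * Pi.mulSingle a (-1)))) / 2 := by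
  have h : ∑ z, f (z * Pi.mulSingle a (-1)) = ∑ z, f z :=
    Fintype.sum_equiv (Equiv.mulRight (Pi.mulSingle a (-1) : κ → ℤˣ)) _ _ fun _ => rfl
  rw [Finset.sum_add_distrib, h]
  ring

omit [Fintype κ] [Fintype ι] in
theorem signSum_insert (V : κ → Matrix ι ι ℝ) {S : Finset κ} {a : κ} (ha : a ∉ S) (z : κ → ℤˣ) :
    signSum V (insert a S) z = signSum V S z + ((z a : ℤ) : ℝ) • V a := by
  rw [signSum, Finset.sum_insert ha, add_comm]; rfl

omit [Fintype κ] [Fintype ι] in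
theorem signSum_insert_flip (V : κ → Matrix ι ι ℝ) {S : Finset κ} {a : κ} (ha : a ∉ S)
    (z : κ → ℤˣ) : signSum V (insert a S) (z * Pi.mulSingle a (-1)) =
      signSum V S z - ((z a : ℤ) : ℝ) • V a := by
  rw [signSum_insert V ha, sub_eq_add_neg, ← neg_smul]
  congr 1
  · refine Finset.sum_congr rfl fun b hb => ?_
    have : b ≠ a := fun h => ha (h ▸ hb)
    simp [Pi.mulSingle_eq_of_ne this]
  · simp

theorem units_cast_mul_self (u : ℤˣ) : ((u : ℤ) : ℝ) * ((u : ℤ) : ℝ) = 1 := by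
  rcases Int.units_eq_one_or u with h | h <;> simp [h]

omit [Fintype κ] [Fintype ι] [DecidableEq κ] in
theorem signSum_isSymm {V : κ → Matrix ι ι ℝ} (hV : ∀ a, (V a).IsSymm) (S : Finset κ)
    (z : κ → ℤˣ) : (signSum V S z).IsSymm :=
  isSymm_sum _ fun a _ => (hV a).smul _

theorem sum_trace_signSum_sq_mul (V : κ → Matrix ι ι ℝ) (X : Matrix ι ι ℝ) (S : Finset κ) :
    ∑ z, ((signSum V S z * signSum V S z) * X).trace =
      Fintype.card (κ → ℤˣ) * ((∑ a ∈ S, V a * V a) * X).trace := by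
  induction S using Finset.induction_on with
  | empty => simp [signSum]
  | insert a S ha ih =>
    rw [sum_signs_eq_half a]
    have : ∀ z : κ → ℤˣ, ((signSum V (insert a S) z * signSum V (insert a S) z) * X).trace
        + ((signSum V (insert a S) (z * Pi.mulSingle a (-1)) *
          signSum V (insert a S) (z * Pi.mulSingle a (-1))) * X).trace
        = 2 * ((signSum V S z * signSum V S z) * X).trace + 2 * ((V a * V a) * X).trace := by
      intro z
      rw [signSum_insert V ha, signSum_insert_flip V ha]
      simp only [add_mul, mul_add, sub_mul, mul_sub, Matrix.trace_add, Matrix.trace_sub,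
        Matrix.smul_mul, Matrix.mul_smul, smul_smul, units_cast_mul_self, one_smul]
      ring
    rw [Finset.sum_congr rfl fun z _ => this z, Finset.sum_add_distrib, ← Finset.mul_sum, ih,
      Finset.sum_insert ha, add_mul, Matrix.trace_add]
    simp only [Finset.sum_const, Finset.card_univ, nsmul_eq_mul]
    ring

theorem trace_mul_mul_mul_le {A V : Matrix ι ι ℝ} (hA : A.IsSymm) (hV : V.IsSymm) :
    (A * V * (A * V)).trace ≤ (A * A * (V * V)).trace := by
  have h : 0 ≤ ((A * V - V * A).transpose * (A * V - V * A)).trace := by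
    simp only [Matrix.trace, Matrix.diag, Matrix.mul_apply, Matrix.transpose_apply]
    exact Finset.sum_nonneg fun i _ => Finset.sum_nonneg fun j _ => mul_self_nonneg _
  have e : (A * V - V * A).transpose * (A * V - V * A)
      = V * (A * A * V) - V * (A * V * A) - A * V * (A * V) + A * (V * V * A) := by
    rw [Matrix.transpose_sub, Matrix.transpose_mul, Matrix.transpose_mul, hA.eq, hV.eq]
    noncomm_ring
  rw [e, Matrix.trace_add, Matrix.trace_sub, Matrix.trace_sub, Matrix.trace_mul_comm V,
    Matrix.trace_mul_comm V, Matrix.trace_mul_comm A (V * V * A)] at h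
  have h1 : (V * V * A * A).trace = (A * A * (V * V)).trace := by
    rw [Matrix.trace_mul_comm (A * A)]; simp only [Matrix.mul_assoc]
  have h2 : (A * A * V * V).trace = (A * A * (V * V)).trace := by simp only [Matrix.mul_assoc]
  have h3 : (A * V * A * V).trace = (A * V * (A * V)).trace := by simp only [Matrix.mul_assoc]
  rw [h1, h2, h3] at h
  linarith

theorem trace_add_pow_four_add_sub_le {A V : Matrix ι ι ℝ} (hA : A.IsSymm) (hV : V.IsSymm) :
    ((A + V) * (A + V) * ((A + V) * (A + V))).trace
      + ((A - V) * (A - V) * ((A - V) * (A - V))).trace ≤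
    2 * (A * A * (A * A)).trace + 12 * (A * A * (V * V)).trace
      + 2 * (V * V * (V * V)).trace := by
  have e : (A + V) * (A + V) * ((A + V) * (A + V)) + (A - V) * (A - V) * ((A - V) * (A - V))
      = (A * A * (A * A) + A * A * (A * A)) + (A * A * (V * V) + A * A * (V * V))
        + (A * (V * V * A) + A * (V * V * A)) + (V * (A * A * V) + V * (A * A * V))
        + (V * V * (A * A) + V * V * (A * A)) + (A * V * (A * V) + A * V * (A * V))
        + (V * (A * V * A) + V * (A * V * A)) + (V * V * (V * V) + V * V * (V * V)) := by
    noncomm_ring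
  rw [← Matrix.trace_add, e]
  simp only [Matrix.trace_add]
  rw [Matrix.trace_mul_comm V (A * A * V), Matrix.trace_mul_comm V (A * V * A),
    Matrix.trace_mul_comm A (V * V * A), Matrix.trace_mul_comm (V * V) (A * A)]
  have h1 : (V * V * A * A).trace = (A * A * (V * V)).trace := by
    rw [Matrix.trace_mul_comm (A * A)]; simp only [Matrix.mul_assoc]
  have h2 : (A * A * V * V).trace = (A * A * (V * V)).trace := by simp only [Matrix.mul_assoc]
  have h3 : (A * V * A * V).trace = (A * V * (A * V)).trace := by simp only [Matrix.mul_assoc]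
  rw [h1, h2, h3]
  linarith [trace_mul_mul_mul_le hA hV]

/-- The fourth moment of a random signed sum of symmetric matrices, `𝔼 tr A⁴ ≤ 3 tr Q²` with
`Q = ∑ a ∈ S, V a ^ 2`. -/
theorem sum_trace_signSum_pow_four_le {V : κ → Matrix ι ι ℝ} (hV : ∀ a, (V a).IsSymm)
    (S : Finset κ) :
    ∑ z, ((signSum V S z * signSum V S z) * (signSum V S z * signSum V S z)).trace ≤
      Fintype.card (κ → ℤˣ) *
        (3 * ((∑ a ∈ S, V a * V a) * (∑ a ∈ S, V a * V a)).trace) := by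
  induction S using Finset.induction_on with
  | empty => simp [signSum]
  | insert a S ha ih =>
    rw [sum_signs_eq_half a]
    have step : ∀ z : κ → ℤˣ,
        ((signSum V (insert a S) z * signSum V (insert a S) z) *
          (signSum V (insert a S) z * signSum V (insert a S) z)).trace
        + ((signSum V (insert a S) (z * Pi.mulSingle a (-1)) *
            signSum V (insert a S) (z * Pi.mulSingle a (-1))) *
          (signSum V (insert a S) (z * Pi.mulSingle a (-1)) *
            signSum V (insert a S) (z * Pi.mulSingle a (-1)))).trace
        ≤ 2 * ((signSum V S z * signSum V S z) * (signSum V S z * signSum V S z)).trace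
          + 12 * ((signSum V S z * signSum V S z) * (V a * V a)).trace
          + 2 * ((V a * V a) * (V a * V a)).trace := by
      intro z
      rw [signSum_insert V ha, signSum_insert_flip V ha]
      have h := trace_add_pow_four_add_sub_le (signSum_isSymm hV S z)
        ((hV a).smul ((z a : ℤ) : ℝ))
      have e : (((z a : ℤ) : ℝ) • V a) * (((z a : ℤ) : ℝ) • V a) = V a * V a := by
        rw [Matrix.smul_mul, Matrix.mul_smul, smul_smul, units_cast_mul_self, one_smul]
      rwa [e] at h
    have hsum := (Finset.sum_le_sum fun z (_ : z ∈ Finset.univ) => step z).trans_eq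
      (show _ = 2 * ∑ z, ((signSum V S z * signSum V S z) *
          (signSum V S z * signSum V S z)).trace + 12 * (Fintype.card (κ → ℤˣ) *
          ((∑ a ∈ S, V a * V a) * (V a * V a)).trace) + Fintype.card (κ → ℤˣ) *
          (2 * ((V a * V a) * (V a * V a)).trace) by
        rw [← sum_trace_signSum_sq_mul, Finset.mul_sum, Finset.mul_sum, Finset.sum_add_distrib,
          Finset.sum_add_distrib, Finset.sum_const, Finset.card_univ, nsmul_eq_mul])
    have hpos : 0 ≤ ((V a * V a) * (V a * V a)).trace := by
      apply trace_sq_nonneg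
      rw [Matrix.IsSymm, Matrix.transpose_mul, (hV a).eq]
    have hcard : (0 : ℝ) ≤ Fintype.card (κ → ℤˣ) := Nat.cast_nonneg _
    have hmul := mul_nonneg hcard hpos
    rw [Finset.sum_insert ha]
    simp only [add_mul, mul_add, Matrix.trace_add]
    rw [Matrix.trace_mul_comm (V a * V a) (∑ a ∈ S, V a * V a)]
    nlinarith

/-- The moment generating function of the decoupled chaos `∑ a, c a z a z' a`. -/
theorem sum_exp_signs_le (c : κ → ℝ) :
    ∑ z : κ → ℤˣ, ∑ z' : κ → ℤˣ, Real.exp (∑ a, c a * (((z a : ℤ) : ℝ) * ((z' a : ℤ) : ℝ))) ≤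
      (Fintype.card (κ → ℤˣ) : ℝ) ^ 2 * Real.exp (∑ a, c a ^ 2 / 2) := by
  have inner : ∀ z : κ → ℤˣ,
      ∑ z' : κ → ℤˣ, Real.exp (∑ a, c a * (((z a : ℤ) : ℝ) * ((z' a : ℤ) : ℝ))) ≤
        Fintype.card (κ → ℤˣ) * Real.exp (∑ a, c a ^ 2 / 2) := by
    intro z
    simp only [Real.exp_sum]
    rw [← Fintype.piFinset_univ, ← Finset.prod_univ_sum (fun _ => Finset.univ)
      (fun a (u : ℤˣ) => Real.exp (c a * (((z a : ℤ) : ℝ) * ((u : ℤ) : ℝ))))]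
    rw [Fintype.card_pi, Nat.cast_prod, ← Finset.prod_mul_distrib]
    refine Finset.prod_le_prod (fun a _ => Finset.sum_nonneg fun u _ => (Real.exp_pos _).le)
      fun a _ => ?_
    have h2 : ∑ u : ℤˣ, Real.exp (c a * (((z a : ℤ) : ℝ) * ((u : ℤ) : ℝ))) = 2 * Real.cosh (c a) := by
      rw [UnitsInt.univ, Finset.sum_pair (by decide), Real.cosh_eq]
      rcases Int.units_eq_one_or (z a) with h | h <;> simp [h] <;> ring
    rw [h2]
    simpa using Real.cosh_le_exp_half_sq (c a)
  calc _ ≤ ∑ _z : κ → ℤˣ, (Fintype.card (κ → ℤˣ) : ℝ) * Real.exp (∑ a, c a ^ 2 / 2) :=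
        Finset.sum_le_sum fun z _ => inner z
    _ = _ := by rw [Finset.sum_const, Finset.card_univ, nsmul_eq_mul]; ring

end RandomSigns

/-! ### Off-diagonal symmetric matrices -/

section OffDiag

variable {n : ℕ}

/-- The positions strictly above the diagonal. -/
abbrev UpperPair (n : ℕ) : Type := {p : Fin n × Fin n // p.1 < p.2}

/-- The orthonormal family `(E_pq + E_qp) / √2`, `p < q`, of traceless symmetric matrices. -/
noncomputable def offDiag (p : UpperPair n) : Matrix (Fin n) (Fin n) ℝ :=
  (√2)⁻¹ • (Matrix.single p.1.1 p.1.2 1 + Matrix.single p.1.2 p.1.1 1)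

theorem inv_sqrt_two_mul_self : (√2)⁻¹ * (√2)⁻¹ = (1 / 2 : ℝ) := by
  rw [← mul_inv, Real.mul_self_sqrt (by norm_num)]; norm_num

theorem offDiag_isSymm (p : UpperPair n) : (offDiag p).IsSymm := by
  simp [offDiag, Matrix.IsSymm, Matrix.transpose_add, add_comm]

theorem trace_offDiag (p : UpperPair n) : (offDiag p).trace = 0 := by
  have h1 : p.1.1 ≠ p.1.2 := p.2.ne
  simp [offDiag, Matrix.trace_add, Matrix.trace_single_eq_of_ne _ _ _ h1,
    Matrix.trace_single_eq_of_ne _ _ _ h1.symm]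

theorem trace_mul_offDiag {R : Matrix (Fin n) (Fin n) ℝ} (hR : R.IsSymm) (p : UpperPair n) :
    (R * offDiag p).trace = (√2)⁻¹ * (2 * R p.1.1 p.1.2) := by
  rw [offDiag, Matrix.mul_smul, Matrix.trace_smul, Matrix.mul_add, Matrix.trace_add,
    Matrix.trace_mul_comm, Matrix.trace_mul_comm R, Matrix.trace_single_mul,
    Matrix.trace_single_mul, hR.apply p.1.1 p.1.2]
  simp; ring_nf

theorem trace_offDiag_mul_offDiag (p q : UpperPair n) :
    (offDiag p * offDiag q).trace = if p = q then 1 else 0 := by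
  rw [trace_mul_offDiag (offDiag_isSymm p)]
  have h1 := p.2
  have h2 := q.2
  have h3 : ¬ (p.1.2 = q.1.1 ∧ p.1.1 = q.1.2) := by
    rintro ⟨h, h'⟩
    rw [← h, ← h'] at h2
    exact absurd (h1.trans h2) (lt_irrefl _)
  have h4 : (p.1.1 = q.1.1 ∧ p.1.2 = q.1.2) ↔ p = q := by
    rw [Subtype.ext_iff, Prod.ext_iff]
  simp only [offDiag, Matrix.smul_apply, Matrix.add_apply, Matrix.single_apply, smul_eq_mul,
    if_neg h3, h4]
  split_ifs
  · linear_combination 2 * inv_sqrt_two_mul_self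
  · simp

/-- A sum over the positions above the diagonal, of a function that is symmetric. -/
theorem two_mul_sum_upperPair (f : Fin n → Fin n → ℝ) (hf : ∀ p q, f p q = f q p) :
    2 * ∑ p : UpperPair n, f p.1.1 p.1.2 + ∑ p, f p p = ∑ p, ∑ q, f p q := by
  have h0 : ∑ p : UpperPair n, f p.1.1 p.1.2
      = ∑ p, ∑ q, if p < q then f p q else 0 := by
    rw [← Fintype.sum_prod_type' (fun p q => if p < q then f p q else 0),
      ← Finset.sum_filter, ← Finset.sum_subtype_eq_sum_filter]
    simp [Finset.subtype_univ]
  have h1 : ∑ p, ∑ q, (if p < q then f p q else 0) = ∑ p, ∑ q, if q < p then f p q else 0 := by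
    rw [Finset.sum_comm]
    exact Finset.sum_congr rfl fun p _ => Finset.sum_congr rfl fun q _ => by rw [hf]
  have h2 : ∑ p, f p p = ∑ p, ∑ q, if p = q then f p q else 0 := by simp
  rw [two_mul, h0]
  nth_rewrite 2 [h1]
  rw [h2, ← Finset.sum_add_distrib, ← Finset.sum_add_distrib]
  refine Finset.sum_congr rfl fun p _ => ?_
  rw [← Finset.sum_add_distrib, ← Finset.sum_add_distrib]
  refine Finset.sum_congr rfl fun q _ => ?_
  rcases lt_trichotomy p q with h | h | h
  · simp [h, h.ne, h.not_gt]
  · simp [h]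
  · simp [h, h.ne', h.not_gt]

theorem card_upperPair : (Fintype.card (UpperPair n) : ℝ) = n * (n - 1) / 2 := by
  have h := two_mul_sum_upperPair (n := n) (fun _ _ => 1) (fun _ _ => rfl)
  simp only [Finset.sum_const, Finset.card_univ, Fintype.card_fin, nsmul_eq_mul, mul_one] at h
  linarith

/-- Bessel's inequality for the off-diagonal family. -/
theorem sum_trace_mul_offDiag_sq_le {R : Matrix (Fin n) (Fin n) ℝ} (hR : R.IsSymm) :
    ∑ p, (R * offDiag p).trace ^ 2 ≤ ∑ p, ∑ q, R p q ^ 2 := by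
  rw [← two_mul_sum_upperPair (fun p q => R p q ^ 2) fun p q => by rw [hR.apply],
    Finset.mul_sum]
  refine le_add_of_le_of_nonneg (le_of_eq ?_) (Finset.sum_nonneg fun _ _ => sq_nonneg _)
  refine Finset.sum_congr rfl fun p _ => ?_
  rw [trace_mul_offDiag hR, mul_pow, sq (√2)⁻¹, inv_sqrt_two_mul_self]
  ring

theorem sum_offDiag_sq :
    ∑ p, offDiag p * offDiag p = (((n : ℝ) - 1) / 2) • (1 : Matrix (Fin n) (Fin n) ℝ) := by
  have h : ∀ p : UpperPair n, offDiag p * offDiag p =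
      (1 / 2 : ℝ) • (Matrix.single p.1.1 p.1.1 1 + Matrix.single p.1.2 p.1.2 1) := by
    intro p
    have h1 : p.1.1 ≠ p.1.2 := p.2.ne
    rw [offDiag, Matrix.smul_mul, Matrix.mul_smul, smul_smul, inv_sqrt_two_mul_self]
    simp [add_mul, mul_add, h1, h1.symm, add_comm]
  ext i j
  rw [Finset.sum_congr rfl fun p _ => h p, Matrix.sum_apply]
  have hs := two_mul_sum_upperPair (n := n)
    (fun p q => (1 / 2 : ℝ) * ((Matrix.single p p (1 : ℝ) + Matrix.single q q 1 : Matrix (Fin n) (Fin n) ℝ) i j))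
    (fun p q => by rw [add_comm])
  simp only [Matrix.smul_apply, smul_eq_mul]
  have hd : ∑ p : Fin n, (Matrix.single p p (1 : ℝ)) i j = (1 : Matrix (Fin n) (Fin n) ℝ) i j := by
    simp [Matrix.single_apply, Matrix.one_apply, ite_and]
  simp only [Matrix.add_apply, mul_add, Finset.sum_add_distrib, ← Finset.mul_sum,
    Finset.sum_const, Finset.card_univ, Fintype.card_fin, nsmul_eq_mul, hd] at hs ⊢
  linarith

/-- Any symmetric form on matrices is diagonalized by a rotation of the off-diagonal family. -/
theorem exists_diagonalizing_family
    (β : Matrix (Fin n) (Fin n) ℝ →ₗ[ℝ] Matrix (Fin n) (Fin n) ℝ →ₗ[ℝ] ℝ)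
    (hβ : ∀ A B, β A B = β B A) :
    ∃ (V : UpperPair n → Matrix (Fin n) (Fin n) ℝ) (l : UpperPair n → ℝ),
      (∀ a, (V a).IsSymm) ∧ (∀ a, (V a).trace = 0) ∧
      (∀ a b, (V a * V b).trace = if a = b then 1 else 0) ∧
      (∑ a, V a * V a = (((n : ℝ) - 1) / 2) • (1 : Matrix (Fin n) (Fin n) ℝ)) ∧
      (∀ a b, β (V a) (V b) = if a = b then l a else 0) ∧
      ∑ a, l a = ∑ p, β (offDiag p) (offDiag p) := by
  let B : Matrix (UpperPair n) (UpperPair n) ℝ := Matrix.of fun p q => β (offDiag p) (offDiag q)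
  have hB : B.IsHermitian := by
    ext p q
    simp [B, hβ (offDiag q)]
  let U : Matrix (UpperPair n) (UpperPair n) ℝ := hB.eigenvectorUnitary
  have hUU : Matrix.transpose U * U = 1 := by
    have := Unitary.coe_star_mul_self hB.eigenvectorUnitary
    rwa [Matrix.star_eq_conjTranspose, Matrix.conjTranspose_eq_transpose_of_trivial] at this
  have hUU' : U * Matrix.transpose U = 1 := by
    have := Unitary.coe_mul_star_self hB.eigenvectorUnitary
    rwa [Unitary.coe_star, Matrix.star_eq_conjTranspose, Matrix.conjTranspose_eq_transpose_of_trivial] at this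
  have hD : Matrix.transpose U * B * U = Matrix.diagonal hB.eigenvalues := by
    have := hB.conjStarAlgAut_star_eigenvectorUnitary
    rw [Unitary.conjStarAlgAut_star_apply, Matrix.star_eq_conjTranspose,
      Matrix.conjTranspose_eq_transpose_of_trivial] at this
    simpa using this
  have hUe : ∀ a b, ∑ k, U k a * U k b = if a = b then 1 else 0 := fun a b => by
    have := congrFun (congrFun hUU a) b
    simpa [Matrix.mul_apply, Matrix.one_apply] using this
  have hUe' : ∀ k l, ∑ a, U k a * U l a = if k = l then 1 else 0 := fun a b => by
    have := congrFun (congrFun hUU' a) b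
    simpa [Matrix.mul_apply, Matrix.one_apply] using this
  refine ⟨fun a => ∑ k, U k a • offDiag k, hB.eigenvalues, fun a => ?_, fun a => ?_,
    fun a b => ?_, ?_, fun a b => ?_, ?_⟩
  · exact isSymm_sum _ fun k _ => (offDiag_isSymm k).smul _
  · simp [Matrix.trace_sum, trace_offDiag]
  · simp only [Finset.sum_mul_sum, Matrix.trace_sum, Matrix.smul_mul, Matrix.mul_smul,
      Matrix.trace_smul, trace_offDiag_mul_offDiag, smul_eq_mul, mul_ite, mul_one, mul_zero,
      Finset.sum_ite_eq, Finset.mem_univ, if_true]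
    rw [← hUe a b]
    exact Finset.sum_congr rfl fun k _ => mul_comm _ _
  · simp only [Finset.sum_mul_sum, Matrix.smul_mul, Matrix.mul_smul, smul_smul]
    rw [Finset.sum_comm]
    rw [← sum_offDiag_sq]
    refine Finset.sum_congr rfl fun k _ => ?_
    rw [Finset.sum_comm, Finset.sum_eq_single k]
    · rw [← Finset.sum_smul, hUe', if_pos rfl, one_smul]
    · intro l _ hl
      rw [← Finset.sum_smul, hUe', if_neg hl, zero_smul]
    · simp
  · have := congrFun (congrFun hD a) b
    rw [Matrix.diagonal_apply] at this
    rw [← this]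
    simp only [map_sum, map_smul, LinearMap.sum_apply, LinearMap.smul_apply, smul_eq_mul,
      Matrix.mul_apply, Matrix.transpose_apply, Finset.mul_sum, Finset.sum_mul, B, Matrix.of_apply]
    exact Finset.sum_congr rfl fun k _ => Finset.sum_congr rfl fun l _ => by ring
  · have := hB.trace_eq_sum_eigenvalues
    simp only [RCLike.ofReal_real_eq_id, id] at this
    rw [← this]; rfl

end OffDiag

/-! ### The sum of the one-copy marginals -/

section Marginal

variable {k n : ℕ}

/-- The sum over the `k` sites of the reduced matrices of `m`. It represents the functional
`E ↦ tr (m * firstOrder k E)`, see `trace_mul_firstOrder`. -/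
def marginalSum (m : Matrix (Fin k → Fin n) (Fin k → Fin n) ℝ) : Matrix (Fin n) (Fin n) ℝ :=
  Matrix.of fun p q => (m * firstOrder k (Matrix.single q p 1)).trace

/-- `firstOrder` as a linear map. -/
def firstOrderₗ (k n : ℕ) :
    Matrix (Fin n) (Fin n) ℝ →ₗ[ℝ] Matrix (Fin k → Fin n) (Fin k → Fin n) ℝ where
  toFun := firstOrder k
  map_add' := firstOrder_add
  map_smul' := firstOrder_smul

theorem trace_mul_firstOrder (m : Matrix (Fin k → Fin n) (Fin k → Fin n) ℝ)
    (E : Matrix (Fin n) (Fin n) ℝ) :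
    (m * firstOrder k E).trace = (marginalSum m * E).trace := by
  have h : firstOrder k E = ∑ q, ∑ p, E q p • firstOrder k (Matrix.single q p 1) := by
    conv_lhs => rw [Matrix.matrix_eq_sum_single E]
    change firstOrderₗ k n _ = _
    simp only [map_sum]
    refine Finset.sum_congr rfl fun q _ => Finset.sum_congr rfl fun p _ => ?_
    rw [show Matrix.single q p (E q p) = E q p • Matrix.single q p (1 : ℝ) by simp, map_smul]
    rfl
  rw [h]
  simp only [Matrix.mul_sum, Matrix.trace_sum, Matrix.mul_smul, Matrix.trace_smul, smul_eq_mul]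
  rw [Finset.sum_comm, Matrix.trace]
  simp only [Matrix.diag, Matrix.mul_apply (M := marginalSum m)]
  exact Finset.sum_congr rfl fun p _ => Finset.sum_congr rfl fun q _ => mul_comm _ _

theorem siteOp_transpose (j : Fin k) (E : Matrix (Fin n) (Fin n) ℝ) :
    (siteOp k j E).transpose = siteOp k j E.transpose := by
  ext a b
  simp only [Matrix.transpose_apply, siteOp_apply]
  congr 1
  refine Finset.prod_congr rfl fun i _ => ?_
  simp [Matrix.one_apply, eq_comm]

theorem firstOrder_one : firstOrder k (1 : Matrix (Fin n) (Fin n) ℝ) = (k : ℝ) • 1 := by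
  have : ∀ j : Fin k, siteOp k j (1 : Matrix (Fin n) (Fin n) ℝ) = 1 := fun j => by
    rw [siteOp, ← tensorProd_one]
    congr 1
    exact Function.update_eq_self j _
  simp [firstOrder, this, Nat.cast_smul_eq_nsmul]

theorem trace_marginalSum (m : Matrix (Fin k → Fin n) (Fin k → Fin n) ℝ) :
    (marginalSum m).trace = k * m.trace := by
  rw [← Matrix.mul_one (marginalSum m), ← trace_mul_firstOrder, firstOrder_one]
  simp

theorem marginalSum_isSymm {m : Matrix (Fin k → Fin n) (Fin k → Fin n) ℝ} (hm : m.IsSymm) :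
    (marginalSum m).IsSymm := by
  ext p q
  simp only [Matrix.transpose_apply, marginalSum, Matrix.of_apply]
  rw [← Matrix.trace_transpose, Matrix.transpose_mul, hm.eq, Matrix.trace_mul_comm]
  simp [firstOrder, Matrix.transpose_sum, siteOp_transpose]

theorem siteOp_mul_siteOp (j : Fin k) (E F : Matrix (Fin n) (Fin n) ℝ) :
    siteOp k j E * siteOp k j F = siteOp k j (E * F) := by
  rw [siteOp, siteOp, siteOp, tensorProd_mul]
  congr 1
  funext i
  by_cases h : i = j
  · subst h; simp
  · simp [h]

theorem marginalSum_posSemidef {m : Matrix (Fin k → Fin n) (Fin k → Fin n) ℝ}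
    (hm : m.PosSemidef) : (marginalSum m).PosSemidef := by
  have hsymm : m.IsSymm := by
    simpa [Matrix.IsHermitian, Matrix.IsSymm, Matrix.conjTranspose_eq_transpose_of_trivial]
      using hm.1
  refine Matrix.PosSemidef.of_dotProduct_mulVec_nonneg ?_ fun x => ?_
  · rw [Matrix.IsHermitian, Matrix.conjTranspose_eq_transpose_of_trivial]
    exact marginalSum_isSymm hsymm
  · obtain ⟨E, hE⟩ : ∃ E, E = Matrix.vecMulVec x x := ⟨_, rfl⟩
    have e : star x ⬝ᵥ ((marginalSum m).mulVec x) = (m * firstOrder k E).trace := by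
      rw [trace_mul_firstOrder, hE, Matrix.mul_vecMulVec, Matrix.trace_vecMulVec, star_trivial,
        dotProduct_comm]
    -- `E = x xᵀ` satisfies `E² = |x|² E`, so `|x|² E` may be replaced by a square.
    have hEE : E * E = (x ⬝ᵥ x) • E := by
      rw [hE, Matrix.vecMulVec_mul_vecMulVec]; ext; simp [Matrix.vecMulVec_apply]; ring
    have hES : E.IsSymm := by
      rw [hE, Matrix.IsSymm, Matrix.transpose_vecMulVec]
    have h1 : 0 ≤ (x ⬝ᵥ x) * (m * firstOrder k E).trace := by
      simp only [firstOrder, Finset.mul_sum, Matrix.trace_sum]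
      refine Finset.sum_nonneg fun j _ => ?_
      have h2 := (hm.mul_mul_conjTranspose_same (siteOp k j E)).trace_nonneg
      rwa [Matrix.conjTranspose_eq_transpose_of_trivial, (siteOp_isSymm j hES).eq,
        Matrix.trace_mul_comm, ← Matrix.mul_assoc, siteOp_mul_siteOp, hEE, siteOp_smul,
        Matrix.trace_mul_comm, Matrix.mul_smul, Matrix.trace_smul, smul_eq_mul] at h2
    rw [e]
    rcases eq_or_ne x 0 with rfl | hx
    · have : E = 0 := by rw [hE]; simp
      rw [trace_mul_firstOrder, this]; simp
    · have hpos : 0 < x ⬝ᵥ x := by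
        simpa using Matrix.dotProduct_star_self_pos_iff.2 hx
      exact nonneg_of_mul_nonneg_right h1 hpos

/-- Bessel's inequality for the first-order response to the off-diagonal family. The bound is
free of the dimension, because `marginalSum m` is positive semidefinite with trace `k * tr m`. -/
theorem sum_trace_mul_firstOrder_offDiag_sq_le
    {m : Matrix (Fin k → Fin n) (Fin k → Fin n) ℝ} (hm : m.PosSemidef) :
    ∑ p : UpperPair n, (m * firstOrder k (offDiag p)).trace ^ 2 ≤ (k * m.trace) ^ 2 := by
  have hsymm : m.IsSymm := by
    simpa [Matrix.IsHermitian, Matrix.IsSymm, Matrix.conjTranspose_eq_transpose_of_trivial]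
      using hm.1
  simp only [trace_mul_firstOrder]
  rw [← trace_marginalSum]
  exact (sum_trace_mul_offDiag_sq_le (marginalSum_isSymm hsymm)).trans
    (marginalSum_posSemidef hm).sum_sq_le_trace_sq

end Marginal

/-! ### The second moment method for product measures -/

section SecondMoment

theorem integrable_of_measurable_of_abs_le {Y : Type*} [MeasurableSpace Y] {P : Measure Y}
    [IsFiniteMeasure P] {f : Y → ℝ} (hf : Measurable f) {C : ℝ} (hC : ∀ y, |f y| ≤ C) :
    Integrable f P :=
  Integrable.of_bound hf.aestronglyMeasurable C (Filter.Eventually.of_forall hC)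

theorem integral_sub_const_sq {Y : Type*} [MeasurableSpace Y] {P : Measure Y}
    [IsProbabilityMeasure P] {f : Y → ℝ} (hf : Integrable f P)
    (hf2 : Integrable (fun y => f y ^ 2) P) (c : ℝ) :
    ∫ y, (f y - c) ^ 2 ∂P = ∫ y, f y ^ 2 ∂P - 2 * c * ∫ y, f y ∂P + c ^ 2 := by
  have h1 : ∀ y, (f y - c) ^ 2 = f y ^ 2 - 2 * c * f y + c ^ 2 := fun y => by ring
  have h2 : Integrable (fun y => f y ^ 2 - 2 * c * f y) P := hf2.sub (hf.const_mul _)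
  simp only [h1]
  rw [integral_add h2 (integrable_const _), integral_sub hf2 (hf.const_mul _),
    integral_const_mul]
  simp

theorem sq_integral_le {Y : Type*} [MeasurableSpace Y] {P : Measure Y} [IsProbabilityMeasure P]
    {f : Y → ℝ} (hf : Integrable f P) (hf2 : Integrable (fun y => f y ^ 2) P) :
    (∫ y, f y ∂P) ^ 2 ≤ ∫ y, f y ^ 2 ∂P := by
  have h : 0 ≤ ∫ y, (f y - ∫ y, f y ∂P) ^ 2 ∂P := integral_nonneg fun _ => sq_nonneg _
  rw [integral_sub_const_sq hf hf2] at h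
  nlinarith

/-- A product of measures with densities has the product of the densities as density. -/
theorem pi_withDensity_ofReal {J : Type*} [Fintype J] {Y : J → Type*}
    [∀ i, MeasurableSpace (Y i)] (P : ∀ i, Measure (Y i)) [∀ i, IsProbabilityMeasure (P i)]
    {L : ∀ i, Y i → ℝ} (h0 : ∀ i y, 0 ≤ L i y)
    (hint : ∀ i, Integrable (L i) (P i)) :
    Measure.pi (fun i => (P i).withDensity fun y => ENNReal.ofReal (L i y)) =
      (Measure.pi P).withDensity fun y => ENNReal.ofReal (∏ i, L i (y i)) := by
  have hfin : ∀ i, IsFiniteMeasure ((P i).withDensity fun y => ENNReal.ofReal (L i y)) := fun i =>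
    isFiniteMeasure_withDensity_ofReal (hint i).2
  refine Measure.pi_eq fun s hs => ?_
  rw [withDensity_apply _ (MeasurableSet.univ_pi hs), Measure.restrict_pi_pi,
    ← ofReal_integral_eq_lintegral_ofReal, integral_fintype_prod_eq_prod,
    ENNReal.ofReal_prod_of_nonneg]
  · refine Finset.prod_congr rfl fun i _ => ?_
    rw [withDensity_apply _ (hs i), ofReal_integral_eq_lintegral_ofReal (hint i).restrict
      (Filter.Eventually.of_forall (h0 i))]
  · exact fun i _ => integral_nonneg (h0 i)
  · exact Integrable.fintype_prod_dep fun i => (hint i).restrict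
  · exact Filter.Eventually.of_forall fun y => Finset.prod_nonneg fun i _ => h0 i _

/-- A test `A` distinguishes a product measure from a mixture of product measures no better than
the `χ²`-divergence of the mixture allows. -/
theorem sq_sub_average_le {J Z : Type*} [Fintype J] [Fintype Z] [Nonempty Z] {Y : J → Type*}
    [∀ i, MeasurableSpace (Y i)] (P : ∀ i, Measure (Y i)) [∀ i, IsProbabilityMeasure (P i)]
    {L : Z → ∀ i, Y i → ℝ} (hm : ∀ z i, Measurable (L z i)) (h0 : ∀ z i y, 0 ≤ L z i y)
    {C : J → ℝ} (hC : ∀ z i y, L z i y ≤ C i) (h1 : ∀ z i, ∫ y, L z i y ∂P i = 1)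
    {A : (∀ i, Y i) → ℝ} (hA : Measurable A) (hA0 : ∀ y, 0 ≤ A y) (hA1 : ∀ y, A y ≤ 1) :
    (∫ y, A y ∂Measure.pi P - (∑ z, ∫ y, A y ∂Measure.pi
        (fun i => (P i).withDensity fun y => ENNReal.ofReal (L z i y))) / Fintype.card Z) ^ 2 ≤
      (∑ z, ∑ z', ∏ i, ∫ y, L z i y * L z' i y ∂P i) / (Fintype.card Z : ℝ) ^ 2 - 1 := by
  have hZ : (0 : ℝ) < Fintype.card Z := Nat.cast_pos.2 Fintype.card_pos
  have hint : ∀ z i, Integrable (L z i) (P i) := fun z i =>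
    integrable_of_measurable_of_abs_le (hm z i) (C := C i) fun y => by
      rw [abs_of_nonneg (h0 z i y)]; exact hC z i y
  obtain ⟨Λ, hΛ⟩ : ∃ Λ : Z → (∀ i, Y i) → ℝ, Λ = fun z y => ∏ i, L z i (y i) := ⟨_, rfl⟩
  have hΛm : ∀ z, Measurable (Λ z) := fun z => by
    rw [hΛ]
    exact Finset.measurable_prod _ fun i _ => (hm z i).comp (measurable_pi_apply i)
  have hΛ0 : ∀ z y, 0 ≤ Λ z y := fun z y => by
    rw [hΛ]; exact Finset.prod_nonneg fun i _ => h0 z i _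
  have hΛC : ∀ z y, Λ z y ≤ ∏ i, C i := fun z y => by
    rw [hΛ]; exact Finset.prod_le_prod (fun i _ => h0 z i _) fun i _ => hC z i _
  have hΛint : ∀ z, ∫ y, Λ z y ∂Measure.pi P = 1 := fun z => by
    rw [hΛ]; simp only
    rw [integral_fintype_prod_eq_prod]; simp [h1]
  have hΛΛ : ∀ z z', ∫ y, Λ z y * Λ z' y ∂Measure.pi P
      = ∏ i, ∫ y, L z i y * L z' i y ∂P i := fun z z' => by
    rw [hΛ]; simp only [← Finset.prod_mul_distrib]
    rw [integral_fintype_prod_eq_prod (fun i y => L z i y * L z' i y)]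
  have hiΛ : ∀ z, Integrable (Λ z) (Measure.pi P) := fun z =>
    integrable_of_measurable_of_abs_le (hΛm z) (C := ∏ i, C i) fun y => by
      rw [abs_of_nonneg (hΛ0 z y)]; exact hΛC z y
  have hiΛΛ : ∀ z z', Integrable (fun y => Λ z y * Λ z' y) (Measure.pi P) := fun z z' =>
    integrable_of_measurable_of_abs_le ((hΛm z).mul (hΛm z')) (C := (∏ i, C i) * ∏ i, C i)
      fun y => by
        rw [abs_of_nonneg (mul_nonneg (hΛ0 z y) (hΛ0 z' y))]
        exact mul_le_mul (hΛC z y) (hΛC z' y) (hΛ0 z' y) ((hΛ0 z y).trans (hΛC z y))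
  have hiA : Integrable A (Measure.pi P) :=
    integrable_of_measurable_of_abs_le hA (C := 1) fun y => by
      rw [abs_of_nonneg (hA0 y)]; exact hA1 y
  have hiAΛ : ∀ z, Integrable (fun y => A y * Λ z y) (Measure.pi P) := fun z =>
    (hiΛ z).bdd_mul (c := 1) hA.aestronglyMeasurable (Filter.Eventually.of_forall fun y => by
      rw [Real.norm_eq_abs, abs_of_nonneg (hA0 y)]; exact hA1 y)
  have hAz : ∀ z, ∫ y, A y ∂Measure.pi (fun i => (P i).withDensity fun y =>
      ENNReal.ofReal (L z i y)) = ∫ y, A y * Λ z y ∂Measure.pi P := fun z => by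
    rw [pi_withDensity_ofReal P (h0 z) (hint z)]
    have hz : (fun y : ∀ i, Y i => ENNReal.ofReal (∏ i, L z i (y i)))
        = fun y => ENNReal.ofReal (Λ z y) := by rw [hΛ]
    rw [hz, integral_withDensity_eq_integral_toReal_smul (hΛm z).ennreal_ofReal
      (Filter.Eventually.of_forall fun _ => ENNReal.ofReal_lt_top)]
    refine integral_congr_ae (Filter.Eventually.of_forall fun y => ?_)
    simp only [ENNReal.toReal_ofReal (hΛ0 z y), smul_eq_mul, mul_comm]
  obtain ⟨G, hG⟩ : ∃ G : (∀ i, Y i) → ℝ, G = fun y => (∑ z, Λ z y) / Fintype.card Z := ⟨_, rfl⟩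
  have hiG : Integrable G (Measure.pi P) := by
    rw [hG]; exact (integrable_finsetSum _ fun z _ => hiΛ z).div_const _
  have hG2 : ∀ y, G y ^ 2 = (∑ z, ∑ z', Λ z y * Λ z' y) / (Fintype.card Z : ℝ) ^ 2 := fun y => by
    rw [hG]; simp only [div_pow, sq (∑ z, Λ z y), Finset.sum_mul_sum]
  have hiG2 : Integrable (fun y => G y ^ 2) (Measure.pi P) := by
    simp only [hG2]
    exact (integrable_finsetSum _ fun z _ => integrable_finsetSum _ fun z' _ =>
      hiΛΛ z z').div_const _
  have hiAG : Integrable (fun y => A y * G y) (Measure.pi P) :=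
    hiG.bdd_mul (c := 1) hA.aestronglyMeasurable (Filter.Eventually.of_forall fun y => by
      rw [Real.norm_eq_abs, abs_of_nonneg (hA0 y)]; exact hA1 y)
  have hIG : ∫ y, G y ∂Measure.pi P = 1 := by
    rw [hG]; simp only
    rw [integral_div, integral_finsetSum _ fun z _ => hiΛ z]
    simp [hΛint, hZ.ne']
  have hIG2 : ∫ y, G y ^ 2 ∂Measure.pi P
      = (∑ z, ∑ z', ∏ i, ∫ y, L z i y * L z' i y ∂P i) / (Fintype.card Z : ℝ) ^ 2 := by
    simp only [hG2]
    rw [integral_div, integral_finsetSum _ fun z _ => integrable_finsetSum _ fun z' _ =>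
      hiΛΛ z z']
    congr 1
    refine Finset.sum_congr rfl fun z _ => ?_
    rw [integral_finsetSum _ fun z' _ => hiΛΛ z z']
    exact Finset.sum_congr rfl fun z' _ => hΛΛ z z'
  have hIAG : ∫ y, A y * G y ∂Measure.pi P = (∑ z, ∫ y, A y * Λ z y ∂Measure.pi P)
      / Fintype.card Z := by
    rw [← integral_finsetSum _ fun z _ => hiAΛ z, ← integral_div]
    refine integral_congr_ae (Filter.Eventually.of_forall fun y => ?_)
    rw [hG]
    simp only [← Finset.mul_sum, mul_div_assoc]
  simp only [hAz]
  rw [← hIAG, ← integral_sub hiA hiAG, ← hIG2]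
  have hi1G2 : Integrable (fun y => (1 - G y) ^ 2) (Measure.pi P) := by
    have : ∀ y, (1 - G y) ^ 2 = 1 - 2 * G y + G y ^ 2 := fun y => by ring
    simp only [this]
    exact ((integrable_const _).sub (hiG.const_mul _)).add hiG2
  have hI1G2 : ∫ y, (1 - G y) ^ 2 ∂Measure.pi P = ∫ y, G y ^ 2 ∂Measure.pi P - 1 := by
    have h := integral_sub_const_sq hiG hiG2 1
    rw [hIG] at h
    simp only [sub_sq_comm (1 : ℝ)]
    rw [h]; ring
  have hle : ∀ y, (A y - A y * G y) ^ 2 ≤ (1 - G y) ^ 2 := fun y => by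
    have : (A y - A y * G y) ^ 2 = A y ^ 2 * (1 - G y) ^ 2 := by ring
    rw [this]
    exact mul_le_of_le_one_left (sq_nonneg _) (pow_le_one₀ (hA0 y) (hA1 y))
  have hi : Integrable (fun y => (A y - A y * G y) ^ 2) (Measure.pi P) :=
    hi1G2.mono ((hiA.sub hiAG).aestronglyMeasurable.pow 2)
      (Filter.Eventually.of_forall fun y => by
        rw [Real.norm_eq_abs, Real.norm_eq_abs, abs_of_nonneg (sq_nonneg _),
          abs_of_nonneg (sq_nonneg _)]
        exact hle y)
  calc _ ≤ ∫ y, (A y - A y * G y) ^ 2 ∂Measure.pi P := sq_integral_le (hiA.sub hiAG) hi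
    _ ≤ ∫ y, (1 - G y) ^ 2 ∂Measure.pi P := integral_mono hi hi1G2 hle
    _ = _ := hI1G2

end SecondMoment

/-! ### Linear statistics of a measurement -/

section Response

variable {ι Y : Type*} [Fintype ι] [DecidableEq ι] [MeasurableSpace Y]

/-- A POVM with real matrices, on the outcome space `Y` with the reference measure `μ`. -/
structure IsRealPOVM (μ : Measure Y) (m : Y → Matrix ι ι ℝ) : Prop where
  posSemidef : ∀ y, (m y).PosSemidef
  measurable : ∀ a b, Measurable fun y => m y a b
  integrable : ∀ a b, Integrable (fun y => m y a b) μ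
  integral_eq_one : ∀ a b, ∫ y, m y a b ∂μ = (1 : Matrix ι ι ℝ) a b

/-- The statistic `tr (m y X) / tr (m y)`. If the state is `X` divided by the dimension, it is the
likelihood ratio to the maximally mixed state. It is zero at outcomes with `tr (m y) = 0`, which
have probability zero. -/
noncomputable def response (m : Y → Matrix ι ι ℝ) (X : Matrix ι ι ℝ) (y : Y) : ℝ :=
  (m y * X).trace / (m y).trace

/-- The law of the outcome when the maximally mixed state is measured. -/
noncomputable def nullLaw (μ : Measure Y) (m : Y → Matrix ι ι ℝ) : Measure Y :=
  μ.withDensity fun y => ENNReal.ofReal ((m y).trace / Fintype.card ι)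

omit [DecidableEq ι] [MeasurableSpace Y] in
theorem response_add (m : Y → Matrix ι ι ℝ) (X X' : Matrix ι ι ℝ) (y : Y) :
    response m (X + X') y = response m X y + response m X' y := by
  simp [response, mul_add, add_div]

omit [DecidableEq ι] [MeasurableSpace Y] in
theorem response_smul (m : Y → Matrix ι ι ℝ) (c : ℝ) (X : Matrix ι ι ℝ) (y : Y) :
    response m (c • X) y = c * response m X y := by
  simp [response, mul_div_assoc]

namespace IsRealPOVM

variable {μ : Measure Y} {m : Y → Matrix ι ι ℝ}

theorem measurable_trace_mul (h : IsRealPOVM μ m) (X : Matrix ι ι ℝ) :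
    Measurable fun y => (m y * X).trace := by
  simp only [Matrix.trace, Matrix.diag, Matrix.mul_apply]
  exact Finset.measurable_sum _ fun a _ => Finset.measurable_sum _ fun b _ =>
    (h.measurable a b).mul_const _

theorem integrable_trace_mul (h : IsRealPOVM μ m) (X : Matrix ι ι ℝ) :
    Integrable (fun y => (m y * X).trace) μ := by
  simp only [Matrix.trace, Matrix.diag, Matrix.mul_apply]
  exact integrable_finsetSum _ fun a _ => integrable_finsetSum _ fun b _ =>
    (h.integrable a b).mul_const _

theorem integral_trace_mul (h : IsRealPOVM μ m) (X : Matrix ι ι ℝ) :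
    ∫ y, (m y * X).trace ∂μ = X.trace := by
  conv_rhs => rw [← Matrix.one_mul X]
  simp only [Matrix.trace, Matrix.diag, Matrix.mul_apply]
  rw [integral_finsetSum _ fun a _ => integrable_finsetSum _ fun b _ =>
    (h.integrable a b).mul_const _]
  refine Finset.sum_congr rfl fun a _ => ?_
  rw [integral_finsetSum _ fun b _ => (h.integrable a b).mul_const _]
  refine Finset.sum_congr rfl fun b _ => ?_
  rw [integral_mul_const, h.integral_eq_one]

theorem trace_mul_eq_zero (h : IsRealPOVM μ m) {y : Y} (hy : (m y).trace = 0)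
    (X : Matrix ι ι ℝ) : (m y * X).trace = 0 := by
  have := (h.posSemidef y).abs_trace_mul_le X
  rw [hy, zero_mul] at this
  exact abs_nonpos_iff.1 this

theorem trace_mul_response (h : IsRealPOVM μ m) (X : Matrix ι ι ℝ) (y : Y) :
    (m y).trace * response m X y = (m y * X).trace := by
  rcases eq_or_ne (m y).trace 0 with hy | hy
  · rw [hy, zero_mul, h.trace_mul_eq_zero hy]
  · rw [response, mul_div_cancel₀ _ hy]

theorem measurable_trace (h : IsRealPOVM μ m) : Measurable fun y => (m y).trace := by
  simpa using h.measurable_trace_mul 1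

theorem measurable_response (h : IsRealPOVM μ m) (X : Matrix ι ι ℝ) :
    Measurable (response m X) :=
  (h.measurable_trace_mul X).div h.measurable_trace

theorem abs_response_le (h : IsRealPOVM μ m) (X : Matrix ι ι ℝ) (y : Y) :
    |response m X y| ≤ ∑ a, ∑ b, |X b a| := by
  rw [response, abs_div, abs_of_nonneg (h.posSemidef y).trace_nonneg]
  exact div_le_of_le_mul₀ (h.posSemidef y).trace_nonneg
    (Finset.sum_nonneg fun _ _ => Finset.sum_nonneg fun _ _ => abs_nonneg _)
    (((h.posSemidef y).abs_trace_mul_le X).trans_eq (mul_comm _ _))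

theorem integral_nullLaw (h : IsRealPOVM μ m) (f : Y → ℝ) :
    ∫ y, f y ∂nullLaw μ m = (∫ y, (m y).trace * f y ∂μ) / Fintype.card ι := by
  have h0 : ∀ y, 0 ≤ (m y).trace / Fintype.card ι := fun y =>
    div_nonneg (h.posSemidef y).trace_nonneg (Nat.cast_nonneg _)
  rw [nullLaw, integral_withDensity_eq_integral_toReal_smul
    (h.measurable_trace.div_const _).ennreal_ofReal
    (Filter.Eventually.of_forall fun _ => ENNReal.ofReal_lt_top), ← integral_div]
  refine integral_congr_ae (Filter.Eventually.of_forall fun y => ?_)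
  simp only [ENNReal.toReal_ofReal (h0 y), smul_eq_mul]
  ring

theorem isProbabilityMeasure_nullLaw [Nonempty ι] (h : IsRealPOVM μ m) :
    IsProbabilityMeasure (nullLaw μ m) := by
  have h0 : ∀ y, 0 ≤ (m y).trace / Fintype.card ι := fun y =>
    div_nonneg (h.posSemidef y).trace_nonneg (Nat.cast_nonneg _)
  have hi : Integrable (fun y => (m y).trace) μ := by simpa using h.integrable_trace_mul 1
  have ht : ∫ y, (m y).trace ∂μ = Fintype.card ι := by simpa using h.integral_trace_mul 1
  constructor
  rw [nullLaw, withDensity_apply _ MeasurableSet.univ, Measure.restrict_univ,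
    ← ofReal_integral_eq_lintegral_ofReal (hi.div_const _) (Filter.Eventually.of_forall h0),
    integral_div, ht, div_self (Nat.cast_ne_zero.2 Fintype.card_ne_zero), ENNReal.ofReal_one]

theorem integral_response (h : IsRealPOVM μ m) (X : Matrix ι ι ℝ) :
    ∫ y, response m X y ∂nullLaw μ m = X.trace / Fintype.card ι := by
  rw [h.integral_nullLaw]
  simp only [h.trace_mul_response, h.integral_trace_mul]

theorem integrable_response_mul [Nonempty ι] (h : IsRealPOVM μ m) (X X' : Matrix ι ι ℝ) :
    Integrable (fun y => response m X y * response m X' y) (nullLaw μ m) := by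
  have := h.isProbabilityMeasure_nullLaw
  refine integrable_of_measurable_of_abs_le ((h.measurable_response X).mul
    (h.measurable_response X')) (C := (∑ a, ∑ b, |X b a|) * ∑ a, ∑ b, |X' b a|) fun y => ?_
  rw [abs_mul]
  exact mul_le_mul (h.abs_response_le X y) (h.abs_response_le X' y) (abs_nonneg _)
    ((abs_nonneg _).trans (h.abs_response_le X y))

/-- The inner product of two statistics under the law of the maximally mixed state. -/
noncomputable def pairing [Nonempty ι] (h : IsRealPOVM μ m) :
    Matrix ι ι ℝ →ₗ[ℝ] Matrix ι ι ℝ →ₗ[ℝ] ℝ :=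
  LinearMap.mk₂ ℝ (fun X X' => ∫ y, response m X y * response m X' y ∂nullLaw μ m)
    (fun X₁ X₂ X' => by
      simp only [response_add, add_mul]
      exact integral_add (h.integrable_response_mul _ _) (h.integrable_response_mul _ _))
    (fun c X X' => by
      simp only [response_smul, mul_assoc, integral_const_mul, smul_eq_mul])
    (fun X X₁ X₂ => by
      simp only [response_add, mul_add]
      exact integral_add (h.integrable_response_mul _ _) (h.integrable_response_mul _ _))
    (fun c X X' => by
      simp only [response_smul, mul_left_comm _ c, integral_const_mul, smul_eq_mul])

variable [Nonempty ι]

theorem pairing_apply (h : IsRealPOVM μ m) (X X' : Matrix ι ι ℝ) :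
    h.pairing X X' = ∫ y, response m X y * response m X' y ∂nullLaw μ m := rfl

theorem pairing_comm (h : IsRealPOVM μ m) (X X' : Matrix ι ι ℝ) :
    h.pairing X X' = h.pairing X' X := by
  simp only [pairing_apply, mul_comm]

theorem pairing_self_nonneg (h : IsRealPOVM μ m) (X : Matrix ι ι ℝ) : 0 ≤ h.pairing X X :=
  integral_nonneg fun _ => mul_self_nonneg _

theorem pairing_one_left (h : IsRealPOVM μ m) (X : Matrix ι ι ℝ) :
    h.pairing 1 X = X.trace / Fintype.card ι := by
  rw [pairing_apply, ← h.integral_response]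
  refine integral_congr_ae (Filter.Eventually.of_forall fun y => ?_)
  simp only [response, Matrix.mul_one]
  rcases eq_or_ne (m y).trace 0 with hy | hy
  · simp [hy]
  · rw [div_self hy, one_mul]

/-- The variance bound: `response m X` has second moment at most `tr (X²) / dim`. -/
theorem pairing_self_le (h : IsRealPOVM μ m) {X : Matrix ι ι ℝ} (hX : X.IsSymm) :
    h.pairing X X ≤ (X * X).trace / Fintype.card ι := by
  have := h.isProbabilityMeasure_nullLaw
  rw [← h.integral_response, pairing_apply]
  refine integral_mono (h.integrable_response_mul _ _)
    (integrable_of_measurable_of_abs_le (h.measurable_response _) (h.abs_response_le _))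
    fun y => ?_
  have hc := (h.posSemidef y).trace_mul_sq_le hX
  have h0 := (h.posSemidef y).trace_nonneg
  simp only [response]
  rcases eq_or_ne (m y).trace 0 with hy | hy
  · simp [hy]
  · have hpos := lt_of_le_of_ne h0 hy.symm
    rw [div_mul_div_comm, div_le_div_iff₀ (by positivity) hpos]
    nlinarith

/-- The arithmetic–geometric mean inequality for the pairing. -/
theorem pairing_le (h : IsRealPOVM μ m) {η : ℝ} (hη : 0 < η) (X X' : Matrix ι ι ℝ) :
    h.pairing X X' ≤ (η * h.pairing X X + h.pairing X' X' / η) / 2 := by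
  have h1 := h.pairing_self_nonneg (η • X - X')
  simp only [map_sub, map_smul, LinearMap.sub_apply, LinearMap.smul_apply, smul_eq_mul,
    h.pairing_comm X' X] at h1
  have h2 : 0 ≤ (η * h.pairing X X + h.pairing X' X' / η) - 2 * h.pairing X X' := by
    have e : (η * h.pairing X X + h.pairing X' X' / η) - 2 * h.pairing X X' =
      (η * (η * h.pairing X X) - η * h.pairing X X' - (η * h.pairing X X' - h.pairing X' X')) / η := by
      field_simp; ring
    rw [e]
    refine div_nonneg ?_ hη.le
    linarith
  linarith

end IsRealPOVM

end Response

section RoundBounds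

theorem card_pi_fin {k n : ℕ} : (Fintype.card (Fin k → Fin n) : ℝ) = (n : ℝ) ^ k := by simp

variable {k n : ℕ} [NeZero n] {Y : Type*} [MeasurableSpace Y] {μ : Measure Y}
  {m : Y → Matrix (Fin k → Fin n) (Fin k → Fin n) ℝ}

namespace IsRealPOVM

theorem pairing_firstOrder_self_le (h : IsRealPOVM μ m) {E : Matrix (Fin n) (Fin n) ℝ}
    (hS : E.IsSymm) (hE : E.trace = 0) :
    h.pairing (firstOrder k E) (firstOrder k E) ≤ k * ((E * E).trace / n) := by
  have := h.pairing_self_le (firstOrder_isSymm (k := k) hS)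
  rwa [card_pi_fin, trace_firstOrder_sq_div hE] at this

theorem sum_pairing_firstOrder_offDiag_le (h : IsRealPOVM μ m) :
    ∑ p : UpperPair n, h.pairing (firstOrder k (offDiag p)) (firstOrder k (offDiag p)) ≤
      (k : ℝ) ^ 2 := by
  have := h.isProbabilityMeasure_nullLaw
  simp only [pairing_apply]
  rw [← integral_finsetSum _ fun p _ => h.integrable_response_mul _ _]
  have hle : ∀ y, ∑ p : UpperPair n, response m (firstOrder k (offDiag p)) y *
      response m (firstOrder k (offDiag p)) y ≤ (k : ℝ) ^ 2 := fun y => by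
    have hB := sum_trace_mul_firstOrder_offDiag_sq_le (h.posSemidef y)
    rcases eq_or_ne (m y).trace 0 with hy | hy
    · simp only [response, hy, div_zero, mul_zero, Finset.sum_const_zero]
      positivity
    · have hpos : 0 < (m y).trace ^ 2 := by positivity
      simp only [response, ← sq, div_pow, ← Finset.sum_div]
      rw [div_le_iff₀ hpos, ← mul_pow]
      exact hB
  calc _ ≤ ∫ _y, (k : ℝ) ^ 2 ∂nullLaw μ m :=
        integral_mono (integrable_finsetSum _ fun p _ => h.integrable_response_mul _ _)
          (integrable_const _) hle
    _ = (k : ℝ) ^ 2 := by simp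

/-- The overlap of the likelihood ratios of two perturbations `E` and `F` of the maximally mixed
state, up to first order. The constant `η` splits the cross terms of first and higher order. -/
theorem pairing_tensorProd_le (h : IsRealPOVM μ m) {E F : Matrix (Fin n) (Fin n) ℝ}
    (hES : E.IsSymm) (hFS : F.IsSymm) (hE : E.trace = 0) (hF : F.trace = 0) {e : ℝ}
    (heE : (E * E).trace / n ≤ e) (heF : (F * F).trace / n ≤ e) (hke : k * e ≤ 1)
    {η : ℝ} (hη : 0 < η) :
    h.pairing (tensorProd fun _ => 1 + E) (tensorProd fun _ => 1 + F) ≤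
      1 + h.pairing (firstOrder k E) (firstOrder k F)
        + k * e * (η + k * e / η + k * e) := by
  have he0 : 0 ≤ e := le_trans (div_nonneg (trace_sq_nonneg hES) (Nat.cast_nonneg n)) heE
  have dec : ∀ G : Matrix (Fin n) (Fin n) ℝ, (tensorProd fun _ : Fin k => 1 + G)
      = 1 + (firstOrder k G + higherOrder k G) := fun G => by
    rw [higherOrder]; abel
  have hfirst : ∀ {G : Matrix (Fin n) (Fin n) ℝ}, G.IsSymm → G.trace = 0 →
      (G * G).trace / n ≤ e → h.pairing (firstOrder k G) (firstOrder k G) ≤ k * e :=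
    fun hS hT he => (h.pairing_firstOrder_self_le hS hT).trans
      (mul_le_mul_of_nonneg_left he (Nat.cast_nonneg k))
  have hhigh : ∀ {G : Matrix (Fin n) (Fin n) ℝ}, G.IsSymm → G.trace = 0 →
      (G * G).trace / n ≤ e → h.pairing (higherOrder k G) (higherOrder k G) ≤ (k * e) ^ 2 := by
    intro G hS hT he
    have h0 : 0 ≤ k * ((G * G).trace / n) :=
      mul_nonneg (Nat.cast_nonneg k) (div_nonneg (trace_sq_nonneg hS) (Nat.cast_nonneg n))
    have h1 : k * ((G * G).trace / n) ≤ k * e := mul_le_mul_of_nonneg_left he (Nat.cast_nonneg k)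
    have h2 := h.pairing_self_le (higherOrder_isSymm (k := k) hS)
    rw [card_pi_fin] at h2
    exact h2.trans ((trace_higherOrder_sq_div_le hS hT (h1.trans hke)).trans
      (pow_le_pow_left₀ h0 h1 2))
  have hz : ∀ {G : Matrix (Fin n) (Fin n) ℝ}, G.trace = 0 →
      h.pairing 1 (firstOrder k G + higherOrder k G) = 0 := fun hT => by
    rw [h.pairing_one_left, Matrix.trace_add, trace_firstOrder hT, trace_higherOrder hT]; simp
  have h11 : h.pairing 1 1 = 1 := by
    rw [h.pairing_one_left, Matrix.trace_one, div_self (Nat.cast_ne_zero.2 Fintype.card_ne_zero)]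
  have hexp : h.pairing (tensorProd fun _ => 1 + E) (tensorProd fun _ => 1 + F) =
      1 + h.pairing (firstOrder k E) (firstOrder k F)
        + h.pairing (firstOrder k E) (higherOrder k F)
        + h.pairing (firstOrder k F) (higherOrder k E)
        + h.pairing (higherOrder k E) (higherOrder k F) := by
    have hzE := hz hE
    have hzF := hz hF
    rw [h.pairing_comm] at hzE
    rw [dec, dec]
    simp only [map_add, LinearMap.add_apply, h11] at hzE hzF ⊢
    rw [h.pairing_comm (higherOrder k E) (firstOrder k F)]
    linarith
  have b1 := h.pairing_le hη (firstOrder k E) (higherOrder k F)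
  have b2 := h.pairing_le hη (firstOrder k F) (higherOrder k E)
  have b3 := h.pairing_le one_pos (higherOrder k E) (higherOrder k F)
  have c1 : h.pairing (higherOrder k F) (higherOrder k F) / η ≤ (k * e) ^ 2 / η :=
    div_le_div_of_nonneg_right (hhigh hFS hF heF) hη.le
  have c2 : h.pairing (higherOrder k E) (higherOrder k E) / η ≤ (k * e) ^ 2 / η :=
    div_le_div_of_nonneg_right (hhigh hES hE heE) hη.le
  have d1 := mul_le_mul_of_nonneg_left (hfirst hES hE heE) hη.le
  have d2 := mul_le_mul_of_nonneg_left (hfirst hFS hF heF) hη.le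
  have f1 := hhigh hES hE heE
  have f2 := hhigh hFS hF heF
  have e1 : k * e * (η + k * e / η + k * e) = η * (k * e) + (k * e) ^ 2 / η + (k * e) ^ 2 := by
    ring
  rw [hexp, e1]
  rw [one_mul, div_one] at b3
  linarith

end IsRealPOVM

end RoundBounds

/-! ### States supported on a coordinate subspace -/

section Embed

variable {d n k : ℕ}

/-- The inclusion of the coordinate subspace picked by `e`, as a matrix. -/
def coordIncl (e : Fin n → Fin d) : Matrix (Fin d) (Fin n) ℂ :=
  (1 : Matrix (Fin d) (Fin d) ℂ).submatrix id e

/-- The real matrix `A`, as a complex matrix on the coordinate subspace picked by `e`, extended by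
zero. -/
def embed (e : Fin n → Fin d) (A : Matrix (Fin n) (Fin n) ℝ) : Matrix (Fin d) (Fin d) ℂ :=
  coordIncl e * A.map Complex.ofReal * (coordIncl e).conjTranspose

theorem coordIncl_conjTranspose_mul {e : Fin n → Fin d} (he : Function.Injective e) :
    (coordIncl e).conjTranspose * coordIncl e = 1 := by
  ext p q
  simp [coordIncl, Matrix.mul_apply, Matrix.one_apply, he.eq_iff, eq_comm]

theorem embed_sub (e : Fin n → Fin d) (A B : Matrix (Fin n) (Fin n) ℝ) :
    embed e A - embed e B = embed e (A - B) := by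
  have : (A - B).map Complex.ofReal = A.map Complex.ofReal - B.map Complex.ofReal := by
    ext; simp
  rw [embed, embed, embed, this, Matrix.mul_sub, Matrix.sub_mul]

theorem embed_mul {e : Fin n → Fin d} (he : Function.Injective e)
    (A B : Matrix (Fin n) (Fin n) ℝ) : embed e A * embed e B = embed e (A * B) := by
  have : (A * B).map Complex.ofReal = A.map Complex.ofReal * B.map Complex.ofReal := by
    ext; simp [Matrix.mul_apply]
  rw [embed, embed, embed, this]
  calc _ = coordIncl e * A.map Complex.ofReal * ((coordIncl e).conjTranspose * coordIncl e)
        * B.map Complex.ofReal * (coordIncl e).conjTranspose := by simp only [Matrix.mul_assoc]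
    _ = _ := by rw [coordIncl_conjTranspose_mul he, Matrix.mul_one]; simp only [Matrix.mul_assoc]

theorem embed_conjTranspose (e : Fin n → Fin d) {A : Matrix (Fin n) (Fin n) ℝ} (hA : A.IsSymm) :
    (embed e A).conjTranspose = embed e A := by
  have : (A.map Complex.ofReal).conjTranspose = A.map Complex.ofReal := by
    ext p q; simp [hA.apply p q]
  rw [embed, Matrix.conjTranspose_mul, Matrix.conjTranspose_mul, this,
    Matrix.conjTranspose_conjTranspose, Matrix.mul_assoc]

theorem trace_embed {e : Fin n → Fin d} (he : Function.Injective e)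
    (A : Matrix (Fin n) (Fin n) ℝ) : (embed e A).trace = A.trace := by
  rw [embed, Matrix.trace_mul_comm, ← Matrix.mul_assoc, coordIncl_conjTranspose_mul he,
    Matrix.one_mul]
  simp [Matrix.trace]

open scoped MatrixOrder in
theorem exists_eq_transpose_mul_self {ι : Type*} [Fintype ι] [DecidableEq ι] {A : Matrix ι ι ℝ}
    (hA : A.PosSemidef) : ∃ C : Matrix ι ι ℝ, A = C.transpose * C := by
  obtain ⟨C, hC⟩ := CStarAlgebra.nonneg_iff_eq_star_mul_self.1 hA.nonneg
  exact ⟨C, by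
    rw [hC, Matrix.star_eq_conjTranspose, Matrix.conjTranspose_eq_transpose_of_trivial]⟩

theorem isState_embed {e : Fin n → Fin d} (he : Function.Injective e)
    {A : Matrix (Fin n) (Fin n) ℝ} (hA : A.PosSemidef) (hT : A.trace = 1) :
    IsState (embed e A) := by
  refine ⟨?_, by rw [trace_embed he, hT]; simp⟩
  refine Matrix.PosSemidef.mul_mul_conjTranspose_same ?_ _
  obtain ⟨C, rfl⟩ := exists_eq_transpose_mul_self hA
  have : (C.transpose * C).map Complex.ofReal
      = (C.map Complex.ofReal).conjTranspose * C.map Complex.ofReal := by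
    ext p q; simp [Matrix.mul_apply]
  rw [this]
  exact Matrix.posSemidef_conjTranspose_mul_self _

theorem le_traceNorm_embed {e : Fin n → Fin d} (he : Function.Injective e)
    {A : Matrix (Fin n) (Fin n) ℝ} (hA : A.IsSymm) {τ : ℝ} (hτ : 0 < τ) :
    (3 * (A * A).trace / τ - ((A * A) * (A * A)).trace / τ ^ 3) / 2 ≤ traceNorm (embed e A) := by
  have h := le_traceNorm (embed e A) hτ
  rwa [embed_conjTranspose e hA, embed_mul he, embed_mul he, trace_embed he, trace_embed he,
    Complex.ofReal_re, Complex.ofReal_re] at h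

theorem embed_apply (e : Fin n → Fin d) (A : Matrix (Fin n) (Fin n) ℝ) (p q : Fin d) :
    embed e A p q = ∑ x : Fin n × Fin n, if p = e x.1 ∧ q = e x.2 then (A x.1 x.2 : ℂ) else 0 := by
  simp only [embed, coordIncl, Matrix.mul_apply, Matrix.submatrix_apply, Matrix.one_apply,
    Matrix.conjTranspose_apply, Matrix.map_apply, id, Finset.sum_mul, Fintype.sum_prod_type]
  rw [Finset.sum_comm]
  refine Finset.sum_congr rfl fun a _ => Finset.sum_congr rfl fun b _ => ?_
  by_cases h1 : p = e a <;> by_cases h2 : q = e b <;> simp [h1, h2]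

theorem tensorPower_embed_apply (e : Fin n → Fin d) (A : Matrix (Fin n) (Fin n) ℝ)
    (a b : Fin k → Fin d) :
    tensorPower k (embed e A) a b = ∑ x : (Fin k → Fin n), ∑ y : (Fin k → Fin n),
      if a = e ∘ x ∧ b = e ∘ y then ((tensorProd fun _ => A) x y : ℂ) else 0 := by
  simp only [tensorPower, Matrix.of_apply, embed_apply]
  rw [Finset.prod_univ_sum, Fintype.piFinset_univ, ← Fintype.sum_prod_type',
    ← (Equiv.arrowProdEquivProdArrow (Fin k) (fun _ => Fin n) fun _ => Fin n).sum_comp]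
  refine Finset.sum_congr rfl fun x _ => ?_
  rw [Fintype.prod_ite_zero]
  simp [Equiv.arrowProdEquivProdArrow, funext_iff, forall_and, tensorProd]

theorem trace_mul_tensorPower_embed (e : Fin n → Fin d) (A : Matrix (Fin n) (Fin n) ℝ)
    (O : Matrix (Fin k → Fin d) (Fin k → Fin d) ℂ) :
    (O * tensorPower k (embed e A)).trace.re =
      (((O.map Complex.re).submatrix (e ∘ ·) (e ∘ ·)) * tensorProd fun _ => A).trace := by
  have h : (O * tensorPower k (embed e A)).trace =
      ∑ x : (Fin k → Fin n), ∑ y : (Fin k → Fin n),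
        O (e ∘ y) (e ∘ x) * ((tensorProd fun _ => A) x y : ℂ) := by
    simp only [Matrix.trace, Matrix.diag, Matrix.mul_apply, tensorPower_embed_apply,
      Finset.mul_sum]
    rw [Finset.sum_comm]
    simp only [Finset.sum_comm (s := (Finset.univ : Finset (Fin k → Fin d)))
      (t := (Finset.univ : Finset (Fin k → Fin n)))]
    refine Finset.sum_congr rfl fun x _ => Finset.sum_congr rfl fun y _ => ?_
    simp [ite_and]
  rw [h, Finset.sum_comm]
  simp [Matrix.trace, Matrix.mul_apply, Complex.re_sum]

end Embed

/-! ### The law of one round -/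

section Round

namespace RandomPOVM

variable {ι : Type*} [Fintype ι] [DecidableEq ι]

/-- The real part of a random POVM, restricted to the coordinates picked by `f`. The seed counts
as part of the outcome. -/
noncomputable def realOp {ι' : Type*} (M : RandomPOVM.{u} ι) (f : ι' → ι)
    (y : M.Seed × M.Outcome) : Matrix ι' ι' ℝ :=
  ((M.op y.1 y.2).map Complex.re).submatrix f f

theorem isRealPOVM_realOp {ι' : Type*} [Fintype ι'] [DecidableEq ι'] (M : RandomPOVM.{u} ι)
    {f : ι' → ι} (hf : Function.Injective f) :
    IsRealPOVM (M.seedLaw ⊗ₘ M.ref) (M.realOp f) := by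
  have hps : ∀ y : M.Seed × M.Outcome, ((M.op y.1 y.2).map Complex.re).PosSemidef := fun y =>
    ((M.isPOVM y.1).posSemidef y.2).map_re
  have hm : ∀ a b, Measurable fun y : M.Seed × M.Outcome => (M.op y.1 y.2 a b).re := fun a b =>
    Complex.measurable_re.comp (M.measurable_op a b)
  have hre : ∀ s a b, Integrable (fun x => (M.op s x a b).re) (M.ref s) := fun s a b =>
    ((M.isPOVM s).integrable a b).re
  have hint1 : ∀ s a b, ∫ x, (M.op s x a b).re ∂M.ref s = (1 : Matrix ι ι ℝ) a b := by
    intro s a b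
    have h1 := integral_re ((M.isPOVM s).integrable a b)
    rw [(M.isPOVM s).integral_eq_one a b] at h1
    refine (h1 : _).trans ?_
    rw [Matrix.one_apply, Matrix.one_apply]
    split_ifs <;> simp
  have htr : ∀ s x, ((M.op s x).map Complex.re).trace = ∑ a, (M.op s x a a).re := fun s x => rfl
  have hi : ∀ a b, Integrable (fun y : M.Seed × M.Outcome => (M.op y.1 y.2 a b).re)
      (M.seedLaw ⊗ₘ M.ref) := by
    intro a b
    refine ⟨(hm a b).aestronglyMeasurable, ?_⟩
    rw [HasFiniteIntegral, Measure.lintegral_compProd (hm a b).enorm]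
    calc _ ≤ ∫⁻ _s, ENNReal.ofReal (Fintype.card ι) ∂M.seedLaw := by
          refine lintegral_mono fun s => ?_
          calc ∫⁻ x, ‖(M.op s x a b).re‖ₑ ∂M.ref s
              ≤ ∫⁻ x, ENNReal.ofReal (∑ a, (M.op s x a a).re) ∂M.ref s := by
                refine lintegral_mono fun x => ?_
                rw [← ofReal_norm, Real.norm_eq_abs]
                exact ENNReal.ofReal_le_ofReal ((hps (s, x)).abs_apply_le_trace a b)
            _ = ENNReal.ofReal (Fintype.card ι) := by
                rw [← ofReal_integral_eq_lintegral_ofReal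
                  (integrable_finsetSum _ fun a _ => hre s a a)
                  (Filter.Eventually.of_forall fun x => (hps (s, x)).trace_nonneg),
                  integral_finsetSum _ fun a _ => hre s a a]
                simp [hint1]
      _ < ⊤ := by simp
  refine ⟨fun y => (hps y).submatrix f, fun a b => hm _ _, fun a b => hi _ _, fun a b => ?_⟩
  have h := Measure.integral_compProd (hi (f a) (f b))
  refine (h : _).trans ?_
  simp [hint1, Matrix.one_apply, hf.eq_iff]

end RandomPOVM

variable {d n k : ℕ}

theorem comp_left_injective {e : Fin n → Fin d} (he : Function.Injective e) :
    Function.Injective (fun x : Fin k → Fin n => e ∘ x) := he.comp_left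

theorem tensorProd_smul (c : ℝ) (A : Matrix (Fin n) (Fin n) ℝ) :
    tensorProd (fun _ : Fin k => c • A) = c ^ k • tensorProd fun _ => A := by
  ext a b
  simp [tensorProd, Finset.prod_mul_distrib]

theorem law_embed (M : RandomPOVM.{u} (Fin k → Fin d)) (e : Fin n → Fin d)
    (A : Matrix (Fin n) (Fin n) ℝ) :
    M.law (tensorPower k (embed e ((n : ℝ)⁻¹ • A))) =
      (M.seedLaw ⊗ₘ M.ref).withDensity fun y => ENNReal.ofReal
        ((M.realOp (e ∘ ·) y * tensorProd fun _ => A).trace / (n : ℝ) ^ k) := by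
  rw [RandomPOVM.law]
  congr 1
  funext y
  rw [trace_mul_tensorPower_embed, tensorProd_smul, Matrix.mul_smul, Matrix.trace_smul,
    smul_eq_mul, inv_pow, div_eq_inv_mul]
  rfl

theorem law_embed_one (M : RandomPOVM.{u} (Fin k → Fin d)) (e : Fin n → Fin d) :
    M.law (tensorPower k (embed e ((n : ℝ)⁻¹ • 1))) =
      nullLaw (M.seedLaw ⊗ₘ M.ref) (M.realOp (e ∘ ·)) := by
  rw [law_embed, nullLaw]
  simp [tensorProd_one]

theorem trace_mul_tensorProd_nonneg {m : Matrix (Fin k → Fin n) (Fin k → Fin n) ℝ}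
    (hm : m.PosSemidef) {A : Matrix (Fin n) (Fin n) ℝ} (hA : A.PosSemidef) :
    0 ≤ (m * tensorProd fun _ => A).trace := by
  obtain ⟨C, rfl⟩ := exists_eq_transpose_mul_self hA
  have h := (hm.mul_mul_conjTranspose_same (tensorProd fun _ : Fin k => C)).trace_nonneg
  have hT : (tensorProd fun _ : Fin k => C).transpose = tensorProd fun _ => C.transpose := by
    ext; simp [tensorProd]
  rwa [Matrix.trace_mul_comm, Matrix.conjTranspose_eq_transpose_of_trivial, hT,
    ← Matrix.mul_assoc, tensorProd_mul, Matrix.trace_mul_comm] at h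

/-- The law under a state on the subspace has density `response` with respect to the law under
the maximally mixed state of the subspace. -/
theorem law_embed_eq_withDensity (M : RandomPOVM.{u} (Fin k → Fin d)) {e : Fin n → Fin d}
    (he : Function.Injective e) (A : Matrix (Fin n) (Fin n) ℝ) :
    M.law (tensorPower k (embed e ((n : ℝ)⁻¹ • A))) =
      (nullLaw (M.seedLaw ⊗ₘ M.ref) (M.realOp (e ∘ ·))).withDensity fun y =>
        ENNReal.ofReal (response (M.realOp (e ∘ ·)) (tensorProd fun _ => A) y) := by
  have h := M.isRealPOVM_realOp (comp_left_injective (k := k) he)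
  rw [law_embed, nullLaw, ← withDensity_mul _ (h.measurable_trace.div_const _).ennreal_ofReal
    (h.measurable_response _).ennreal_ofReal]
  congr 1
  funext y
  rw [Pi.mul_apply, ← ENNReal.ofReal_mul (div_nonneg (h.posSemidef y).trace_nonneg
    (Nat.cast_nonneg _)), div_mul_eq_mul_div, h.trace_mul_response, card_pi_fin]

end Round

/-! ### Directions in which a measurement is insensitive -/

section HardFamily

variable {n : ℕ}

theorem sq_div_four_le_card_upperPair (hn : 2 ≤ n) :
    (n : ℝ) ^ 2 / 4 ≤ Fintype.card (UpperPair n) := by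
  have h2 : (2 : ℝ) ≤ n := by exact_mod_cast hn
  rw [card_upperPair]; nlinarith

theorem card_upperPair_le : (Fintype.card (UpperPair n) : ℝ) ≤ (n : ℝ) ^ 2 / 2 := by
  have h0 : (0 : ℝ) ≤ n := Nat.cast_nonneg n
  rw [card_upperPair]; nlinarith

/-- An orthonormal family that diagonalizes the form `β`, together with the set `S` of those of
its members on which `β` is at most twice its average. At least half of them are in `S`. -/
theorem exists_insensitive_family (hn : 2 ≤ n)
    (β : Matrix (Fin n) (Fin n) ℝ →ₗ[ℝ] Matrix (Fin n) (Fin n) ℝ →ₗ[ℝ] ℝ)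
    (hβ : ∀ A B, β A B = β B A) (hβ0 : ∀ A, 0 ≤ β A A) {θ G : ℝ}
    (hθ : ∀ E : Matrix (Fin n) (Fin n) ℝ, E.IsSymm → E.trace = 0 → β E E ≤ θ * (E * E).trace)
    (hG0 : 0 < G) (hG : ∑ p : UpperPair n, β (offDiag p) (offDiag p) ≤ G) :
    ∃ (V : UpperPair n → Matrix (Fin n) (Fin n) ℝ) (l : UpperPair n → ℝ)
      (S : Finset (UpperPair n)),
      (∀ a, (V a).IsSymm) ∧ (∀ a, (V a).trace = 0) ∧
      (∀ a b, (V a * V b).trace = if a = b then 1 else 0) ∧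
      (∑ a, V a * V a = (((n : ℝ) - 1) / 2) • (1 : Matrix (Fin n) (Fin n) ℝ)) ∧
      (∀ a b, β (V a) (V b) = if a = b then l a else 0) ∧
      (∀ a, 0 ≤ l a) ∧ (∀ a, l a ≤ θ) ∧ (∀ a ∈ S, l a ≤ 8 * G / (n : ℝ) ^ 2) ∧
      (n : ℝ) ^ 2 / 8 ≤ S.card := by
  obtain ⟨V, l, hVS, hVT, hVo, hVQ, hVβ, hl⟩ := exists_diagonalizing_family β hβ
  have hl0 : ∀ a, 0 ≤ l a := fun a => by have := hβ0 (V a); rwa [hVβ, if_pos rfl] at this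
  have hlθ : ∀ a, l a ≤ θ := fun a => by
    have := hθ (V a) (hVS a) (hVT a)
    rwa [hVβ, if_pos rfl, hVo, if_pos rfl, mul_one] at this
  have hn0 : (0 : ℝ) < n := by exact_mod_cast two_pos.trans_le hn
  refine ⟨V, l, Finset.univ.filter fun a => l a ≤ 8 * G / (n : ℝ) ^ 2, hVS, hVT, hVo, hVQ, hVβ,
    hl0, hlθ, fun a ha => (Finset.mem_filter.1 ha).2, ?_⟩
  have hsplit := Finset.card_filter_add_card_filter_not (s := (Finset.univ : Finset (UpperPair n)))
    (fun a => l a ≤ 8 * G / (n : ℝ) ^ 2)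
  -- Markov's inequality for the eigenvalues, whose sum is at most `G`
  have hmarkov : ((Finset.univ.filter fun a => ¬ l a ≤ 8 * G / (n : ℝ) ^ 2).card : ℝ)
      * (8 * G / (n : ℝ) ^ 2) ≤ G := by
    calc _ = ∑ a ∈ Finset.univ.filter fun a => ¬ l a ≤ 8 * G / (n : ℝ) ^ 2,
          (8 * G / (n : ℝ) ^ 2) := by rw [Finset.sum_const, nsmul_eq_mul]
      _ ≤ ∑ a ∈ Finset.univ.filter fun a => ¬ l a ≤ 8 * G / (n : ℝ) ^ 2, l a :=
          Finset.sum_le_sum fun a ha => (not_le.1 (Finset.mem_filter.1 ha).2).le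
      _ ≤ ∑ a, l a := Finset.sum_le_univ_sum_of_nonneg hl0
      _ ≤ G := hl ▸ hG
  have hbad : ((Finset.univ.filter fun a => ¬ l a ≤ 8 * G / (n : ℝ) ^ 2).card : ℝ)
      ≤ (n : ℝ) ^ 2 / 8 := by
    rw [mul_div_assoc', div_le_iff₀ (by positivity)] at hmarkov
    rw [le_div_iff₀ (by norm_num)]
    exact le_of_mul_le_mul_right (by linarith) hG0
  have hcard := sq_div_four_le_card_upperPair hn
  have hsplit' : ((Finset.univ.filter fun a => l a ≤ 8 * G / (n : ℝ) ^ 2).card : ℝ)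
      + ((Finset.univ.filter fun a => ¬ l a ≤ 8 * G / (n : ℝ) ^ 2).card : ℝ)
      = Fintype.card (UpperPair n) := by
    rw [← Finset.card_univ]; exact_mod_cast hsplit
  linarith

section Orthonormal

variable {κ : Type*} [DecidableEq κ] {V : κ → Matrix (Fin n) (Fin n) ℝ}

omit [DecidableEq κ] in
theorem trace_signSum (hV : ∀ a, (V a).trace = 0) (S : Finset κ) (z : κ → ℤˣ) :
    (signSum V S z).trace = 0 := by
  simp [signSum, Matrix.trace_sum, hV]

theorem form_signSum (β : Matrix (Fin n) (Fin n) ℝ →ₗ[ℝ] Matrix (Fin n) (Fin n) ℝ →ₗ[ℝ] ℝ)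
    {l : κ → ℝ} (hVβ : ∀ a b, β (V a) (V b) = if a = b then l a else 0) (S : Finset κ)
    (z z' : κ → ℤˣ) :
    β (signSum V S z) (signSum V S z') =
      ∑ a ∈ S, l a * (((z a : ℤ) : ℝ) * ((z' a : ℤ) : ℝ)) := by
  simp only [signSum, map_sum, map_smul, LinearMap.sum_apply, LinearMap.smul_apply, hVβ,
    smul_eq_mul, mul_ite, mul_zero]
  refine Finset.sum_congr rfl fun a ha => ?_
  rw [Finset.sum_ite_eq_of_mem' S a _ ha]
  ring

theorem trace_signSum_sq (hVo : ∀ a b, (V a * V b).trace = if a = b then 1 else 0)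
    (S : Finset κ) (z : κ → ℤˣ) : (signSum V S z * signSum V S z).trace = S.card := by
  simp only [signSum, Finset.sum_mul_sum, Matrix.trace_sum, Matrix.smul_mul, Matrix.mul_smul,
    Matrix.trace_smul, hVo, smul_eq_mul, mul_ite, mul_zero, mul_one]
  rw [Finset.sum_congr rfl (g := fun _ => (1 : ℝ)) fun a ha => ?_]
  · simp
  · rw [Finset.sum_ite_eq_of_mem S a _ ha, units_cast_mul_self]

omit [DecidableEq κ] in
theorem trace_sum_sq_mono [Fintype κ] (hVS : ∀ a, (V a).IsSymm) (S : Finset κ) :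
    ((∑ a ∈ S, V a * V a) * (∑ a ∈ S, V a * V a)).trace ≤
      ((∑ a, V a * V a) * (∑ a, V a * V a)).trace := by
  have h0 : ∀ a b, 0 ≤ (V a * V a * (V b * V b)).trace := fun a b => by
    have h : (V a * V a * (V b * V b)).trace
        = ((V a * V b).transpose * (V a * V b)).trace := by
      rw [Matrix.transpose_mul, (hVS a).eq, (hVS b).eq, ← Matrix.mul_assoc,
        Matrix.trace_mul_comm]
      simp only [Matrix.mul_assoc]
    rw [h]
    simp only [Matrix.trace, Matrix.diag, Matrix.mul_apply, Matrix.transpose_apply]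
    exact Finset.sum_nonneg fun i _ => Finset.sum_nonneg fun j _ => mul_self_nonneg _
  simp only [Finset.sum_mul_sum, Matrix.trace_sum]
  calc _ ≤ ∑ a ∈ S, ∑ b, (V a * V a * (V b * V b)).trace :=
        Finset.sum_le_sum fun a _ => Finset.sum_le_univ_sum_of_nonneg (h0 a)
    _ ≤ _ := Finset.sum_le_univ_sum_of_nonneg fun a => Finset.sum_nonneg fun b _ => h0 a b

/-- By Markov's inequality, at most a quarter of the signs give a large fourth moment. -/
theorem card_large_fourth_moment_le [Fintype κ] (hn : 0 < n) (hVS : ∀ a, (V a).IsSymm)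
    (hVQ : ∑ a, V a * V a = (((n : ℝ) - 1) / 2) • (1 : Matrix (Fin n) (Fin n) ℝ))
    (S : Finset κ) :
    ((Finset.univ.filter fun z : κ → ℤˣ => ¬ ((signSum V S z * signSum V S z) *
      (signSum V S z * signSum V S z)).trace ≤ 3 * (n : ℝ) ^ 3).card : ℝ) ≤
      Fintype.card (κ → ℤˣ) / 4 := by
  obtain ⟨f, hf⟩ : ∃ f : (κ → ℤˣ) → ℝ, f = fun z => ((signSum V S z * signSum V S z) *
      (signSum V S z * signSum V S z)).trace := ⟨_, rfl⟩
  have hn0 : (0 : ℝ) < n := by exact_mod_cast hn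
  have hn1 : (1 : ℝ) ≤ n := by exact_mod_cast hn
  have hC : (0 : ℝ) ≤ Fintype.card (κ → ℤˣ) := Nat.cast_nonneg _
  have hf0 : ∀ z, 0 ≤ f z := fun z => by
    rw [hf]
    apply trace_sq_nonneg
    rw [Matrix.IsSymm, Matrix.transpose_mul, (signSum_isSymm hVS S z).eq]
  have hQ : ((∑ a ∈ S, V a * V a) * (∑ a ∈ S, V a * V a)).trace ≤ (n : ℝ) ^ 3 / 4 := by
    refine (trace_sum_sq_mono hVS S).trans ?_
    rw [hVQ]
    simp only [Matrix.smul_mul, Matrix.mul_smul, Matrix.one_mul, Matrix.trace_smul,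
      Matrix.trace_one, Fintype.card_fin, smul_eq_mul]
    nlinarith [mul_nonneg hn0.le (by linarith : (0 : ℝ) ≤ 2 * n - 1)]
  have hsum : ∑ z, f z ≤ Fintype.card (κ → ℤˣ) * (3 * ((n : ℝ) ^ 3 / 4)) := by
    rw [hf]
    exact (sum_trace_signSum_pow_four_le hVS S).trans
      (mul_le_mul_of_nonneg_left (by linarith) hC)
  have hmarkov : ((Finset.univ.filter fun z => ¬ f z ≤ 3 * (n : ℝ) ^ 3).card : ℝ)
      * (3 * (n : ℝ) ^ 3) ≤ ∑ z, f z := by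
    calc _ = ∑ z ∈ Finset.univ.filter fun z => ¬ f z ≤ 3 * (n : ℝ) ^ 3, (3 * (n : ℝ) ^ 3) := by
          rw [Finset.sum_const, nsmul_eq_mul]
      _ ≤ ∑ z ∈ Finset.univ.filter fun z => ¬ f z ≤ 3 * (n : ℝ) ^ 3, f z :=
          Finset.sum_le_sum fun a ha => (not_le.1 (Finset.mem_filter.1 ha).2).le
      _ ≤ _ := Finset.sum_le_univ_sum_of_nonneg hf0
  have hpos : (0 : ℝ) < 3 * (n : ℝ) ^ 3 := by positivity
  have := hmarkov.trans hsum
  subst hf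
  refine le_of_mul_le_mul_right (this.trans_eq ?_) hpos
  ring

end Orthonormal

end HardFamily

/-! ### The information form of a tester -/

section InfoForm

variable {d t n : ℕ}

namespace PrivateTester

theorem acceptProb_le_one (T : PrivateTester.{u} d t) {ρ : Matrix (Fin d) (Fin d) ℂ}
    (h : ∀ i, IsProbabilityMeasure ((T.meas i).law (tensorPower (T.size i) ρ))) :
    T.acceptProb ρ ≤ 1 := by
  have hi : Integrable T.accept
      (Measure.pi fun i => (T.meas i).law (tensorPower (T.size i) ρ)) :=
    integrable_of_measurable_of_abs_le T.measurable_accept (C := 1) fun y => by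
      rw [abs_of_nonneg (T.accept_nonneg y)]; exact T.accept_le_one y
  calc T.acceptProb ρ
      ≤ ∫ _y, (1 : ℝ) ∂(Measure.pi fun i => (T.meas i).law (tensorPower (T.size i) ρ)) :=
        integral_mono hi (integrable_const _) T.accept_le_one
    _ = 1 := by simp

variable (T : PrivateTester.{u} d t) {e : Fin n → Fin d}

theorem isRealPOVM_round (he : Function.Injective e) (i : Fin T.rounds) :
    IsRealPOVM ((T.meas i).seedLaw ⊗ₘ (T.meas i).ref) ((T.meas i).realOp (e ∘ ·)) :=
  (T.meas i).isRealPOVM_realOp (comp_left_injective he)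

variable [NeZero n]

/-- The form `(A, B) ↦ ∑ i, pairing (firstOrder A) (firstOrder B)`: the total first-order
information that the rounds of the tester give on perturbations of the maximally mixed state. -/
noncomputable def infoForm (he : Function.Injective e) :
    Matrix (Fin n) (Fin n) ℝ →ₗ[ℝ] Matrix (Fin n) (Fin n) ℝ →ₗ[ℝ] ℝ :=
  ∑ i, ((T.isRealPOVM_round he i).pairing).compl₁₂ (firstOrderₗ (T.size i) n)
    (firstOrderₗ (T.size i) n)

theorem infoForm_apply (he : Function.Injective e) (A B : Matrix (Fin n) (Fin n) ℝ) :
    T.infoForm he A B = ∑ i, (T.isRealPOVM_round he i).pairing (firstOrder (T.size i) A)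
      (firstOrder (T.size i) B) := by
  simp only [infoForm, LinearMap.sum_apply, LinearMap.compl₁₂_apply]
  rfl

theorem infoForm_self_le (he : Function.Injective e) {E : Matrix (Fin n) (Fin n) ℝ}
    (hS : E.IsSymm) (hE : E.trace = 0) :
    T.infoForm he E E ≤ T.copies / n * (E * E).trace := by
  rw [infoForm_apply]
  refine (Finset.sum_le_sum fun i _ =>
    (T.isRealPOVM_round he i).pairing_firstOrder_self_le hS hE).trans_eq ?_
  rw [← Finset.sum_mul, copies]
  push_cast
  ring

theorem sum_infoForm_offDiag_le (he : Function.Injective e) :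
    ∑ p : UpperPair n, T.infoForm he (offDiag p) (offDiag p) ≤ t * T.copies := by
  simp only [infoForm_apply]
  rw [Finset.sum_comm]
  refine (Finset.sum_le_sum fun i _ =>
    (T.isRealPOVM_round he i).sum_pairing_firstOrder_offDiag_le).trans ?_
  rw [copies, Nat.cast_sum, Finset.mul_sum]
  refine Finset.sum_le_sum fun i _ => ?_
  rw [sq]
  exact mul_le_mul_of_nonneg_right (by exact_mod_cast T.size_le i) (Nat.cast_nonneg _)

/-- The product over the rounds of the overlaps of two likelihood ratios. -/
theorem prod_overlap_le (he : Function.Injective e) {E F : Matrix (Fin n) (Fin n) ℝ}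
    (hES : E.IsSymm) (hFS : F.IsSymm)
    (hE : E.trace = 0) (hF : F.trace = 0) (hEp : (1 + E).PosSemidef) (hFp : (1 + F).PosSemidef)
    {r : ℝ} (heE : (E * E).trace / n ≤ r) (heF : (F * F).trace / n ≤ r) (hr : t * r ≤ 1)
    {η : ℝ} (hη : 0 < η) :
    ∏ i, (T.isRealPOVM_round he i).pairing (tensorProd fun _ => 1 + E)
        (tensorProd fun _ => 1 + F) ≤
      Real.exp (T.infoForm he E F + T.copies * r * (η + t * r / η + t * r)) := by
  have hr0 : 0 ≤ r := le_trans (div_nonneg (trace_sq_nonneg hES) (Nat.cast_nonneg n)) heE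
  have hsize : ∀ i, (T.size i : ℝ) ≤ t := fun i => by exact_mod_cast T.size_le i
  have hpos : ∀ {G : Matrix (Fin n) (Fin n) ℝ}, (1 + G).PosSemidef → ∀ i y,
      0 ≤ response ((T.meas i).realOp (e ∘ ·)) (tensorProd fun _ => 1 + G) y := fun hG i y =>
    div_nonneg (trace_mul_tensorProd_nonneg ((T.isRealPOVM_round he i).posSemidef y) hG)
      ((T.isRealPOVM_round he i).posSemidef y).trace_nonneg
  have hround : ∀ i, (T.isRealPOVM_round he i).pairing (tensorProd fun _ => 1 + E)
      (tensorProd fun _ => 1 + F) ≤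
      Real.exp ((T.isRealPOVM_round he i).pairing (firstOrder (T.size i) E)
        (firstOrder (T.size i) F) + T.size i * (r * (η + t * r / η + t * r))) := by
    intro i
    have hk : (T.size i : ℝ) * r ≤ t * r := mul_le_mul_of_nonneg_right (hsize i) hr0
    have h := (T.isRealPOVM_round he i).pairing_tensorProd_le hES hFS hE hF heE heF
      (hk.trans hr) hη
    have h2 : (T.size i : ℝ) * r * (η + T.size i * r / η + T.size i * r) ≤
        T.size i * (r * (η + t * r / η + t * r)) := by
      rw [← mul_assoc]
      refine mul_le_mul_of_nonneg_left ?_ (mul_nonneg (Nat.cast_nonneg _) hr0)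
      have := div_le_div_of_nonneg_right hk hη.le
      linarith
    have h3 := Real.add_one_le_exp ((T.isRealPOVM_round he i).pairing (firstOrder (T.size i) E)
        (firstOrder (T.size i) F) + T.size i * (r * (η + t * r / η + t * r)))
    linarith
  refine (Finset.prod_le_prod (fun i _ => ?_) fun i _ => hround i).trans_eq ?_
  · exact integral_nonneg fun y => mul_nonneg (hpos hEp i y) (hpos hFp i y)
  · rw [← Real.exp_sum, Finset.sum_add_distrib, ← T.infoForm_apply he, ← Finset.sum_mul, copies]
    push_cast
    ring_nf

/-- The tester distinguishes the maximally mixed state of the subspace from a finite mixture of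
its perturbations no better than the `χ²`-divergence allows. -/
theorem sq_acceptProb_sub_average_le (he : Function.Injective e) {Z : Type*} [Fintype Z] [Nonempty Z]
    {E : Z → Matrix (Fin n) (Fin n) ℝ} (hE : ∀ z, (E z).trace = 0)
    (hEp : ∀ z, (1 + E z).PosSemidef) :
    (T.acceptProb (embed e ((n : ℝ)⁻¹ • 1)) -
      (∑ z, T.acceptProb (embed e ((n : ℝ)⁻¹ • (1 + E z)))) / Fintype.card Z) ^ 2 ≤
    (∑ z, ∑ z', ∏ i, (T.isRealPOVM_round he i).pairing (tensorProd fun _ => 1 + E z)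
        (tensorProd fun _ => 1 + E z')) / (Fintype.card Z : ℝ) ^ 2 - 1 := by
  have hprob := fun i => (T.isRealPOVM_round he i).isProbabilityMeasure_nullLaw
  have h := sq_sub_average_le (fun i => nullLaw ((T.meas i).seedLaw ⊗ₘ (T.meas i).ref)
      ((T.meas i).realOp (e ∘ ·)))
    (L := fun z i => response ((T.meas i).realOp (e ∘ ·)) (tensorProd fun _ => 1 + E z))
    (C := fun i => ∑ z, ∑ a, ∑ b, |tensorProd (fun _ : Fin (T.size i) => 1 + E z) b a|)
    (fun z i => (T.isRealPOVM_round he i).measurable_response _)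
    (fun z i y => div_nonneg
      (trace_mul_tensorProd_nonneg ((T.isRealPOVM_round he i).posSemidef y) (hEp z))
      ((T.isRealPOVM_round he i).posSemidef y).trace_nonneg)
    (fun z i y => ((le_abs_self _).trans ((T.isRealPOVM_round he i).abs_response_le _ y)).trans
      (Finset.single_le_sum
        (f := fun z => ∑ a, ∑ b, |tensorProd (fun _ : Fin (T.size i) => 1 + E z) b a|)
        (fun z _ => Finset.sum_nonneg fun _ _ => Finset.sum_nonneg fun _ _ => abs_nonneg _)
        (Finset.mem_univ z)))
    (fun z i => by
      have hn : (n : ℝ) ≠ 0 := Nat.cast_ne_zero.2 (NeZero.ne n)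
      rw [(T.isRealPOVM_round he i).integral_response, trace_tensorProd, card_pi_fin]
      simp [Matrix.trace_add, hE, hn])
    T.measurable_accept T.accept_nonneg T.accept_le_one
  simp only [acceptProb, law_embed_one]
  simp only [law_embed_eq_withDensity _ he]
  exact h

theorem isProbabilityMeasure_law_embed (he : Function.Injective e) {E : Matrix (Fin n) (Fin n) ℝ}
    (hE : E.trace = 0)
    (hEp : (1 + E).PosSemidef) (i : Fin T.rounds) :
    IsProbabilityMeasure
      ((T.meas i).law (tensorPower (T.size i) (embed e ((n : ℝ)⁻¹ • (1 + E))))) := by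
  have h := T.isRealPOVM_round he i
  have := h.isProbabilityMeasure_nullLaw
  have hn : (n : ℝ) ≠ 0 := Nat.cast_ne_zero.2 (NeZero.ne n)
  constructor
  rw [law_embed_eq_withDensity _ he, withDensity_apply _ MeasurableSet.univ,
    Measure.restrict_univ, ← ofReal_integral_eq_lintegral_ofReal
      (integrable_of_measurable_of_abs_le (h.measurable_response _) (h.abs_response_le _))
      (Filter.Eventually.of_forall fun y => div_nonneg
        (trace_mul_tensorProd_nonneg (h.posSemidef y) hEp) (h.posSemidef y).trace_nonneg),
    h.integral_response, trace_tensorProd, card_pi_fin]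
  simp [Matrix.trace_add, hE, hn]

end PrivateTester

end InfoForm

/-! ### Lower bounds on the number of copies -/

section LowerBound

variable {d t n : ℕ}

/-- A perturbation of the maximally mixed state of the subspace in a direction with small fourth
moment is far from it in trace norm. The scale `s = 64 ε / √n` makes the typical trace norm a
constant multiple of `ε`, and the constant `64` is large enough for the bound. -/
theorem le_traceNorm_perturbation {e : Fin n → Fin d} (he : Function.Injective e) (hn : 0 < n)
    {A : Matrix (Fin n) (Fin n) ℝ} (hA : A.IsSymm) {ε s : ℝ} (hε : 0 < ε)
    (hs : s ^ 2 = 4096 * ε ^ 2 / n) (h2 : (n : ℝ) ^ 2 / 8 ≤ (A * A).trace)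
    (h4 : ((A * A) * (A * A)).trace ≤ 3 * (n : ℝ) ^ 3) :
    ε ≤ traceNorm (embed e ((n : ℝ)⁻¹ • (1 + s • A)) - embed e ((n : ℝ)⁻¹ • 1)) := by
  have hn0 : (0 : ℝ) < n := by exact_mod_cast hn
  have hD : (n : ℝ)⁻¹ • (1 + s • A) - (n : ℝ)⁻¹ • 1 = ((n : ℝ)⁻¹ * s) • A := by
    rw [smul_add, smul_smul, add_sub_cancel_left]
  rw [embed_sub, hD]
  obtain ⟨c, hc⟩ : ∃ c, c = (n : ℝ)⁻¹ * s := ⟨_, rfl⟩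
  have hc2 : c ^ 2 = 4096 * ε ^ 2 / (n : ℝ) ^ 3 := by
    rw [hc, mul_pow, hs]; field_simp
  rw [← hc]
  -- `256 ε / n` is the order of magnitude of a typical singular value of the perturbation
  have h := le_traceNorm_embed he (hA.smul c) (τ := 256 * ε / n) (by positivity)
  refine le_trans ?_ h
  have e2 : ((c • A) * (c • A)).trace = c ^ 2 * (A * A).trace := by
    simp only [Matrix.smul_mul, Matrix.mul_smul, Matrix.trace_smul, smul_eq_mul]; ring
  have e4 : (((c • A) * (c • A)) * ((c • A) * (c • A))).trace
      = (c ^ 2) ^ 2 * ((A * A) * (A * A)).trace := by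
    simp only [Matrix.smul_mul, Matrix.mul_smul, Matrix.trace_smul, smul_eq_mul]; ring
  rw [e2, e4, hc2]
  have b2 : 6 * ε ≤ 3 * (4096 * ε ^ 2 / (n : ℝ) ^ 3 * (A * A).trace) / (256 * ε / n) := by
    have : 3 * (4096 * ε ^ 2 / (n : ℝ) ^ 3 * (A * A).trace) / (256 * ε / n)
        = 48 * ε / (n : ℝ) ^ 2 * (A * A).trace := by field_simp; ring
    rw [this]
    calc 6 * ε = 48 * ε / (n : ℝ) ^ 2 * ((n : ℝ) ^ 2 / 8) := by field_simp; ring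
      _ ≤ _ := mul_le_mul_of_nonneg_left h2 (by positivity)
  have b4 : (4096 * ε ^ 2 / (n : ℝ) ^ 3) ^ 2 * ((A * A) * (A * A)).trace / (256 * ε / n) ^ 3
      ≤ 3 * ε := by
    have : (4096 * ε ^ 2 / (n : ℝ) ^ 3) ^ 2 * ((A * A) * (A * A)).trace / (256 * ε / n) ^ 3
        = ε / (n : ℝ) ^ 3 * ((A * A) * (A * A)).trace := by field_simp; ring
    rw [this]
    calc _ ≤ ε / (n : ℝ) ^ 3 * (3 * (n : ℝ) ^ 3) := mul_le_mul_of_nonneg_left h4 (by positivity)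
      _ = 3 * ε := by field_simp
  linarith

/-- The decoupled chaos of the form `β` along directions in which `β` is small. -/
theorem sum_exp_form_signSum_le (hn : 0 < n)
    (β : Matrix (Fin n) (Fin n) ℝ →ₗ[ℝ] Matrix (Fin n) (Fin n) ℝ →ₗ[ℝ] ℝ)
    {V : UpperPair n → Matrix (Fin n) (Fin n) ℝ} {l : UpperPair n → ℝ}
    (hVβ : ∀ a b, β (V a) (V b) = if a = b then l a else 0) (hl0 : ∀ a, 0 ≤ l a)
    {S : Finset (UpperPair n)} {s : ℝ} (hl : ∀ a ∈ S, s ^ 2 * l a ≤ 1 / (4 * n)) :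
    ∑ z, ∑ z', Real.exp (β (s • signSum V S z) (s • signSum V S z')) ≤
      (Fintype.card (UpperPair n → ℤˣ) : ℝ) ^ 2 * Real.exp (1 / 64) := by
  have hn0 : (0 : ℝ) < n := by exact_mod_cast hn
  obtain ⟨c, hc⟩ : ∃ c : UpperPair n → ℝ, c = fun a => if a ∈ S then s ^ 2 * l a else 0 :=
    ⟨_, rfl⟩
  have hform : ∀ z z', β (s • signSum V S z) (s • signSum V S z')
      = ∑ a, c a * (((z a : ℤ) : ℝ) * ((z' a : ℤ) : ℝ)) := fun z z' => by
    simp only [map_smul, LinearMap.smul_apply, smul_eq_mul, form_signSum _ hVβ, hc, ite_mul,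
      zero_mul, Finset.mul_sum]
    rw [Finset.sum_ite_mem, Finset.univ_inter]
    exact Finset.sum_congr rfl fun a _ => by ring
  have hca : ∀ a, c a ^ 2 / 2 ≤ (1 / (4 * n)) ^ 2 / 2 := fun a => by
    have h01 : 0 ≤ c a ∧ c a ≤ 1 / (4 * n) := by
      rw [hc]
      dsimp only
      split_ifs with h
      · exact ⟨mul_nonneg (sq_nonneg s) (hl0 a), hl a h⟩
      · exact ⟨le_rfl, by positivity⟩
    exact div_le_div_of_nonneg_right (pow_le_pow_left₀ h01.1 h01.2 2) (by norm_num)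
  have hsum : ∑ a, c a ^ 2 / 2 ≤ 1 / 64 := by
    calc _ ≤ ∑ _a : UpperPair n, (1 / (4 * (n : ℝ))) ^ 2 / 2 := Finset.sum_le_sum fun a _ => hca a
      _ = Fintype.card (UpperPair n) * ((1 / (4 * (n : ℝ))) ^ 2 / 2) := by
          rw [Finset.sum_const, Finset.card_univ, nsmul_eq_mul]
      _ ≤ (n : ℝ) ^ 2 / 2 * ((1 / (4 * (n : ℝ))) ^ 2 / 2) :=
          mul_le_mul_of_nonneg_right card_upperPair_le (by positivity)
      _ = 1 / 64 := by field_simp; norm_num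
  simp only [hform]
  exact (sum_exp_signs_le c).trans
    (mul_le_mul_of_nonneg_left (Real.exp_le_exp.2 hsum) (sq_nonneg _))

/-- A tester with few copies does not certify the maximally mixed state of an `n`-dimensional
subspace, because it takes a mixture of perturbations in insensitive directions for that state. -/
theorem not_certifies_of_copies_le (T : PrivateTester.{u} d t) {e : Fin n → Fin d}
    (he : Function.Injective e) (hn : 2 ≤ n) (ht : 1 ≤ t) {ε N : ℝ} (hε : 0 < ε)
    (hεn : ε * ((n : ℝ) ^ 2 * t) ≤ 1 / 4096) (hN0 : 0 < N) (hTN : (T.copies : ℝ) ≤ N)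
    (hN : N * ε ^ 2 ≤ n / 131072 ∨ N * (t * ε ^ 2) ≤ (n : ℝ) ^ 2 / 131072) :
    ¬ T.Certifies ε (embed e ((n : ℝ)⁻¹ • 1)) := by
  rintro ⟨hacc, hrej⟩
  have hnpos : 0 < n := two_pos.trans_le hn
  have : NeZero n := ⟨hnpos.ne'⟩
  have hn2 : (2 : ℝ) ≤ n := by exact_mod_cast hn
  have hn0 : (0 : ℝ) < n := by linarith
  have ht1 : (1 : ℝ) ≤ t := by exact_mod_cast ht
  have ht0 : (0 : ℝ) < t := by linarith
  have hnn : (n : ℝ) ≤ (n : ℝ) ^ 2 := by nlinarith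
  have hNε : N * ε ^ 2 ≤ (n : ℝ) ^ 2 / 131072 := by
    rcases hN with h | h
    · linarith
    · have h0 : 0 ≤ N * ε ^ 2 := by positivity
      nlinarith
  have hεt : (n : ℝ) ^ 2 * (t * ε) ≤ 1 / 4096 := by linarith
  have htε : t * ε ≤ 1 / 16384 := by
    have h0 : 0 < t * ε := by positivity
    nlinarith
  have hε1 : ε ≤ 1 / 16384 := by nlinarith
  have hεn1 : n * ε ≤ 1 / 4096 := by
    have h0 : 0 < n * ε := by positivity
    have h1 : n * ε ≤ (n : ℝ) ^ 2 * (t * ε) := by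
      have : n * ε * 1 ≤ n * ε * (n * t) :=
        mul_le_mul_of_nonneg_left (by nlinarith) h0.le
      linarith
    linarith
  -- the insensitive directions of the information form of the tester
  obtain ⟨V, l, S, hVS, hVT, hVo, hVQ, hVβ, hl0, hlθ, hlS, hcardS⟩ :=
    exists_insensitive_family hn (T.infoForm he)
      (fun A B => by
        simp only [T.infoForm_apply he]
        exact Finset.sum_congr rfl fun i _ => (T.isRealPOVM_round he i).pairing_comm _ _)
      (fun A => by
        rw [T.infoForm_apply he]
        exact Finset.sum_nonneg fun i _ => (T.isRealPOVM_round he i).pairing_self_nonneg _)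
      (θ := N / n) (G := t * N)
      (fun E hS hE => (T.infoForm_self_le he hS hE).trans
        (mul_le_mul_of_nonneg_right (div_le_div_of_nonneg_right hTN hn0.le) (trace_sq_nonneg hS)))
      (by positivity)
      ((T.sum_infoForm_offDiag_le he).trans (mul_le_mul_of_nonneg_left hTN ht0.le))
  obtain ⟨s, hs⟩ : ∃ s : ℝ, s ^ 2 = 4096 * ε ^ 2 / n :=
    ⟨√(4096 * ε ^ 2 / n), Real.sq_sqrt (by positivity)⟩
  let E : (UpperPair n → ℤˣ) → Matrix (Fin n) (Fin n) ℝ := fun z => s • signSum V S z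
  have hES : ∀ z, (E z).IsSymm := fun z => (signSum_isSymm hVS S z).smul s
  have hET : ∀ z, (E z).trace = 0 := fun z => by
    simp [E, trace_signSum hVT]
  have hSn : (S.card : ℝ) ≤ (n : ℝ) ^ 2 / 2 :=
    le_trans (by exact_mod_cast S.card_le_univ) card_upperPair_le
  have hEE : ∀ z, (E z * E z).trace ≤ 2048 * ε ^ 2 * n := fun z => by
    have h1 : (E z * E z).trace = s ^ 2 * S.card := by
      simp only [E, Matrix.smul_mul, Matrix.mul_smul, Matrix.trace_smul, smul_eq_mul,
        trace_signSum_sq hVo]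
      ring
    rw [h1, hs]
    calc _ ≤ 4096 * ε ^ 2 / n * ((n : ℝ) ^ 2 / 2) :=
          mul_le_mul_of_nonneg_left hSn (by positivity)
      _ = _ := by field_simp; ring
  have hEp : ∀ z, (1 + E z).PosSemidef := fun z => by
    refine posSemidef_one_add (hES z) ((hEE z).trans ?_)
    have : 2048 * ε ^ 2 * n = 2048 * (ε * (n * ε)) := by ring
    rw [this]
    nlinarith
  have hEr : ∀ z, (E z * E z).trace / n ≤ 2048 * ε ^ 2 := fun z => by
    rw [div_le_iff₀ hn0]; exact hEE z
  obtain ⟨C, hC⟩ : ∃ C : ℝ, C = Fintype.card (UpperPair n → ℤˣ) := ⟨_, rfl⟩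
  have hC0 : 0 < C := by rw [hC]; exact Nat.cast_pos.2 Fintype.card_pos
  have htr : t * (2048 * ε ^ 2) ≤ 1 := by
    have h0 : t * (2048 * ε ^ 2) = 2048 * ε * (t * ε) := by ring
    have h1 : 2048 * ε * (t * ε) ≤ 1 * (t * ε) :=
      mul_le_mul_of_nonneg_right (by linarith) (by positivity)
    linarith
  -- the second moment of the mixture
  have hchi : (∑ z, ∑ z', ∏ i, (T.isRealPOVM_round he i).pairing (tensorProd fun _ => 1 + E z)
      (tensorProd fun _ => 1 + E z')) ≤ C ^ 2 * Real.exp (1 / 32) := by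
    have hrem : T.copies * (2048 * ε ^ 2) * (t * ε + t * (2048 * ε ^ 2) / (t * ε)
        + t * (2048 * ε ^ 2)) ≤ 1 / 64 := by
      have h1 : t * (2048 * ε ^ 2) / (t * ε) = 2048 * ε := by field_simp
      have h2 : t * ε + 2048 * ε + t * (2048 * ε ^ 2) ≤ 2050 * (t * ε) := by
        have a1 : 2048 * ε ≤ 2048 * (t * ε) := by nlinarith
        have a2 : t * (2048 * ε ^ 2) = t * ε * (2048 * ε) := by ring
        have a3 : t * ε * (2048 * ε) ≤ t * ε * 1 :=
          mul_le_mul_of_nonneg_left (by linarith) (by positivity)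
        linarith
      rw [h1]
      have h0 : 0 < t * ε := by positivity
      calc _ ≤ N * (2048 * ε ^ 2) * (2050 * (t * ε)) :=
            mul_le_mul (mul_le_mul_of_nonneg_right hTN (by positivity)) h2 (by positivity)
              (by positivity)
        _ = 2048 * 2050 * ((N * ε ^ 2) * (t * ε)) := by ring
        _ ≤ 2048 * 2050 * ((n : ℝ) ^ 2 / 131072 * (t * ε)) := by gcongr
        _ = 2048 * 2050 / 131072 * ((n : ℝ) ^ 2 * (t * ε)) := by ring
        _ ≤ 2048 * 2050 / 131072 * (1 / 4096) := by gcongr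
        _ ≤ 1 / 64 := by norm_num
    -- each of the two bounds on the eigenvalues suffices in one of the two regimes of `N`
    have hlc : ∀ a ∈ S, s ^ 2 * l a ≤ 1 / (4 * n) := fun a ha => by
      rw [hs]
      rcases hN with h | h
      · calc _ ≤ 4096 * ε ^ 2 / n * (N / n) :=
              mul_le_mul_of_nonneg_left (hlθ a) (by positivity)
          _ = 4096 / (n : ℝ) ^ 2 * (N * ε ^ 2) := by field_simp
          _ ≤ 4096 / (n : ℝ) ^ 2 * (n / 131072) := by gcongr
          _ = 1 / (32 * n) := by field_simp; norm_num
          _ ≤ 1 / (4 * n) := by gcongr; norm_num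
      · calc _ ≤ 4096 * ε ^ 2 / n * (8 * (t * N) / (n : ℝ) ^ 2) :=
              mul_le_mul_of_nonneg_left (hlS a ha) (by positivity)
          _ = 32768 / (n : ℝ) ^ 3 * (N * (t * ε ^ 2)) := by field_simp; norm_num
          _ ≤ 32768 / (n : ℝ) ^ 3 * ((n : ℝ) ^ 2 / 131072) := by gcongr
          _ = 1 / (4 * n) := by field_simp; norm_num
    have hpair : ∀ z z', ∏ i, (T.isRealPOVM_round he i).pairing (tensorProd fun _ => 1 + E z)
        (tensorProd fun _ => 1 + E z') ≤
        Real.exp (1 / 64) * Real.exp (T.infoForm he (E z) (E z')) := by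
      intro z z'
      -- `η = t ε` balances the two error terms in the overlap
      refine (T.prod_overlap_le he (hES z) (hES z') (hET z) (hET z') (hEp z) (hEp z') (hEr z)
        (hEr z') htr (η := t * ε) (by positivity)).trans ?_
      rw [← Real.exp_add]
      exact Real.exp_le_exp.2 (by linarith)
    calc _ ≤ ∑ z, ∑ z', Real.exp (1 / 64) * Real.exp (T.infoForm he (E z) (E z')) :=
          Finset.sum_le_sum fun z _ => Finset.sum_le_sum fun z' _ => hpair z z'
      _ = Real.exp (1 / 64) * ∑ z, ∑ z', Real.exp (T.infoForm he (E z) (E z')) := by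
          simp only [Finset.mul_sum]
      _ ≤ Real.exp (1 / 64) * (C ^ 2 * Real.exp (1 / 64)) := by
          rw [hC]
          exact mul_le_mul_of_nonneg_left (sum_exp_form_signSum_le hnpos _ hVβ hl0 hlc)
            (Real.exp_pos _).le
      _ = C ^ 2 * Real.exp (1 / 32) := by
          rw [mul_left_comm, ← Real.exp_add]; norm_num
  -- most perturbations are far, so the tester rejects the mixture with good probability
  have havg : (∑ z, T.acceptProb (embed e ((n : ℝ)⁻¹ • (1 + E z)))) ≤ 26 / 100 * C := by
    have hbad := card_large_fourth_moment_le hnpos hVS hVQ S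
    have hpt : ∀ z, T.acceptProb (embed e ((n : ℝ)⁻¹ • (1 + E z))) ≤ 1 / 100 +
        if ¬ ((signSum V S z * signSum V S z) * (signSum V S z * signSum V S z)).trace
          ≤ 3 * (n : ℝ) ^ 3 then 1 else 0 := by
      intro z
      split_ifs with h
      · have hfar := hrej (embed e ((n : ℝ)⁻¹ • (1 + E z)))
          (isState_embed he ((hEp z).smul (by positivity)) (by
            simp [Matrix.trace_add, hET z, hn0.ne']))
          (le_traceNorm_perturbation he hnpos (signSum_isSymm hVS S z) hε hs
            (by rw [trace_signSum_sq hVo]; exact hcardS) h)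
        linarith
      · have := T.acceptProb_le_one (T.isProbabilityMeasure_law_embed he (hET z) (hEp z))
        linarith
    calc _ ≤ ∑ z, ((1 : ℝ) / 100 + if ¬ ((signSum V S z * signSum V S z) *
          (signSum V S z * signSum V S z)).trace ≤ 3 * (n : ℝ) ^ 3 then 1 else 0) :=
          Finset.sum_le_sum fun z _ => hpt z
      _ = C / 100 + ((Finset.univ.filter fun z : UpperPair n → ℤˣ =>
          ¬ ((signSum V S z * signSum V S z) * (signSum V S z * signSum V S z)).trace
            ≤ 3 * (n : ℝ) ^ 3).card : ℝ) := by
          rw [Finset.sum_add_distrib, Finset.sum_const, Finset.card_univ, nsmul_eq_mul, ← hC,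
            Finset.sum_boole]
          ring
      _ ≤ _ := by rw [← hC] at hbad; linarith
  have hmain := T.sq_acceptProb_sub_average_le he hET hEp
  rw [← hC] at hmain
  have h1 : (∑ z, T.acceptProb (embed e ((n : ℝ)⁻¹ • (1 + E z)))) / C ≤ 26 / 100 := by
    rw [div_le_iff₀ hC0]; exact havg
  have h2 : (∑ z, ∑ z', ∏ i, (T.isRealPOVM_round he i).pairing (tensorProd fun _ => 1 + E z)
      (tensorProd fun _ => 1 + E z')) / C ^ 2 ≤ Real.exp (1 / 32) := by
    rw [div_le_iff₀ (by positivity), mul_comm]; exact hchi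
  have h3 := (abs_le.1 (Real.abs_exp_sub_one_sub_id_le (x := 1 / 32)
    (by rw [abs_of_pos] <;> norm_num))).2
  nlinarith

/-- The lower bound of dimension `n` for testers on a space of dimension `d`, of which `e` picks an
`n`-dimensional coordinate subspace. -/
theorem copiesSuffice_lower_bound {e : Fin n → Fin d} (he : Function.Injective e) (hn : 2 ≤ n)
    (ht : 1 ≤ t) {ε : ℝ} (hε : 0 < ε) (hεn : ε ≤ 1 / 4096 / ((n : ℝ) ^ 2 * t)) {N : ℕ}
    (hN : CopiesSuffice.{u} d t ε N) :
    1 / 131072 * max ((n : ℝ) ^ 2 / (t * ε ^ 2)) (n / ε ^ 2) ≤ N := by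
  have hn0 : (0 : ℝ) < n := by exact_mod_cast (two_pos.trans_le hn)
  have ht0 : (0 : ℝ) < t := by exact_mod_cast ht
  have hstate : IsState (embed e ((n : ℝ)⁻¹ • (1 : Matrix (Fin n) (Fin n) ℝ))) :=
    isState_embed he (Matrix.PosSemidef.one.smul (by positivity)) (by simp [hn0.ne'])
  obtain ⟨T, hTN, hT⟩ := hN _ hstate
  by_contra hlt
  rw [not_le] at hlt
  have hTN' : (T.copies : ℝ) ≤ N := by exact_mod_cast hTN
  refine not_certifies_of_copies_le T he hn ht hε ((le_div_iff₀ (by positivity)).1 hεn)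
    (N := 1 / 131072 * max ((n : ℝ) ^ 2 / (t * ε ^ 2)) (n / ε ^ 2)) (by positivity)
    (hTN'.trans hlt.le) ?_ hT
  rcases max_choice ((n : ℝ) ^ 2 / (t * ε ^ 2)) (n / ε ^ 2) with h | h
  · right
    rw [h]
    refine le_of_eq ?_
    field_simp
  · left
    rw [h]
    refine le_of_eq ?_
    field_simp

end LowerBound

theorem mainTheorem5 :
    ∃ c₀ : ℝ, 0 < c₀ ∧ ∃ c : ℝ, 0 < c ∧
      (∀ (d t : ℕ) (ε : ℝ), 2 ≤ d → 1 ≤ t → 0 < ε → ε ≤ c₀ / t →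
        ∀ N : ℕ, CopiesSuffice.{u} d t ε N →
          c * min ((d : ℝ) ^ 2 / (t * ε ^ 2)) (1 / ((t : ℝ) ^ 2 * ε ^ 3)) ≤ N) ∧
      (∀ (d t : ℕ) (ε : ℝ), 2 ≤ d → 1 ≤ t → 0 < ε → ε ≤ c₀ / ((d : ℝ) ^ 2 * t) →
        ∀ N : ℕ, CopiesSuffice.{u} d t ε N →
          c * max ((d : ℝ) ^ 2 / (t * ε ^ 2)) ((d : ℝ) / ε ^ 2) ≤ N) := by
  refine ⟨1 / 16384, by norm_num, 1 / 131072 / 16384, by norm_num, ?_, ?_⟩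
  · intro d t ε hd ht hε hεt N hN
    have ht0 : (0 : ℝ) < t := by exact_mod_cast ht
    rw [le_div_iff₀ ht0] at hεt
    have hx0 : 0 < 1 / 4096 / (t * ε) := by positivity
    -- the largest dimension in which the bound for small `ε` applies
    obtain ⟨r, hr⟩ : ∃ r, r = Nat.sqrt ⌊1 / 4096 / (t * ε)⌋₊ := ⟨_, rfl⟩
    have hr2 : 2 ≤ r := by
      rw [hr, Nat.le_sqrt', Nat.le_floor_iff hx0.le, le_div_iff₀ (by positivity)]
      push_cast; linarith
    have hr_le : (r : ℝ) ^ 2 ≤ 1 / 4096 / (t * ε) := by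
      have h1 : r ^ 2 ≤ ⌊1 / 4096 / (t * ε)⌋₊ := by rw [hr]; exact Nat.sqrt_le' _
      calc (r : ℝ) ^ 2 = ((r ^ 2 : ℕ) : ℝ) := by push_cast; ring
        _ ≤ ⌊1 / 4096 / (t * ε)⌋₊ := by exact_mod_cast h1
        _ ≤ _ := Nat.floor_le hx0.le
    have hr_lt : 1 / 4096 / (t * ε) < ((r : ℝ) + 1) ^ 2 := by
      have h1 : ⌊1 / 4096 / (t * ε)⌋₊ < (r + 1) ^ 2 := by
        rw [hr]; exact Nat.lt_succ_sqrt' _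
      rw [Nat.floor_lt hx0.le] at h1
      exact_mod_cast h1
    have hsmall : ∀ n : ℕ, 2 ≤ n → n ≤ r → ε ≤ 1 / 4096 / ((n : ℝ) ^ 2 * t) := by
      intro n hn hnr
      have hn0 : (0 : ℝ) < n := by exact_mod_cast (two_pos.trans_le hn)
      have h1 : (n : ℝ) ^ 2 ≤ 1 / 4096 / (t * ε) := le_trans (by gcongr) hr_le
      rw [le_div_iff₀ (by positivity)] at h1 ⊢
      linarith
    rcases le_total d r with hdr | hdr
    · have h := copiesSuffice_lower_bound (e := id) Function.injective_id hd ht hε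
        (hsmall d hd hdr) hN
      refine le_trans ?_ h
      exact mul_le_mul (by norm_num) ((min_le_left _ _).trans (le_max_left _ _))
        (by positivity) (by norm_num)
    · have h := copiesSuffice_lower_bound (Fin.castLE_injective hdr) hr2 ht hε
        (hsmall r hr2 le_rfl) hN
      have hr0 : (2 : ℝ) ≤ r := by exact_mod_cast hr2
      refine le_trans ?_ ((mul_le_mul_of_nonneg_left (le_max_left _ _) (by norm_num)).trans h)
      have h4 : 1 / 4096 / (t * ε) ≤ 4 * (r : ℝ) ^ 2 := by nlinarith
      calc _ ≤ 1 / 131072 / 16384 * (1 / ((t : ℝ) ^ 2 * ε ^ 3)) :=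
            mul_le_mul_of_nonneg_left (min_le_right _ _) (by norm_num)
        _ = 1 / 131072 * ((1 / 4096 / (t * ε)) / 4 / (t * ε ^ 2)) := by field_simp; norm_num
        _ ≤ 1 / 131072 * ((r : ℝ) ^ 2 / (t * ε ^ 2)) := by gcongr; linarith
  · intro d t ε hd ht hε hεd N hN
    have ht0 : (0 : ℝ) < t := by exact_mod_cast ht
    have hd0 : (0 : ℝ) < d := by exact_mod_cast (two_pos.trans_le hd)
    have h := copiesSuffice_lower_bound (e := id) Function.injective_id hd ht hε
      (hεd.trans (div_le_div_of_nonneg_right (by norm_num) (by positivity))) hN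
    exact (mul_le_mul_of_nonneg_right (by norm_num) (by positivity)).trans h
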